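/- Let $K$ be a field. For an integer matrix $A\in\mathbb Z^{m\times n}$ with columns $a_1,\dots,a_n$ let $\mathrm{Ker}_{\mathbb Z}(A)=\{u\in\mathbb Z^n: Au=0\}$ and let $I_A\subseteq K[x_1,\dots,x_n]$ be its toric ideal, generated by the binomials $x^{u^+}-x^{u^-}$, $u\in\mathrm{Ker}_{\mathbb Z}(A)$ (where $u=u^+-u^-$ with $u^\pm\in\mathbb N^n$ of disjoint supports). Let $b_1,\dots,b_n$ be the rows of a Gale transform of $A$, i.e. of a matrix whose columns form a basis of $\mathrm{Ker}_{\mathbb Z}(A)$. The bouquet graph of $A$ has vertices $1,\dots,n$ (one for each column), and $j\neq k$ are adjacent when each of $b_j,b_k$ is a rational multiple of the other; its connected components are the bouquets of $A$. A bouquet is free if $b_j=0$ for its elements $j$; it is non-mixed if it is not free and for every edge $\{j,k\}$ in it $b_j=\lambda b_k$ with $\lambda>0$; the other bouquets are mixed. A toric ideal is simple if all its bouquets are singletons. Number the bouquets $B_1,\dots,B_s$ and fix a first element $i1$ in each $B_i$. Define $c_{B_i}\in\mathbb Z^n$, with support $B_i$, as follows. If $B_i$ is not free, choose a coordinate $l$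 in which all $b_j$ $(j\in B_i)$ are nonzero and put $(c_{B_i})_j=\varepsilon\,(b_j)_l/g$ for $j\in B_i$, where $g=\gcd\{(b_k)_l:k\in B_i\}$ and $\varepsilon$ is the sign of $(b_{i1})_l$ (the result does not depend on $l$). If $B_i$ is free, let $c_{B_i}$ be any vector with support exactly $B_i$ and positive $i1$-coordinate. The toric ideal of the matrix with columns $a_{B_i}=\sum_j (c_{B_i})_j a_j$, $1\le i\le s$, is the bouquet ideal of $A$, and $D(u)=\sum_{i=1}^s u_i c_{B_i}$ for $u\in\mathbb Z^s$. For an integer matrix $T$ with $s$ columns whose toric ideal $I_T$ is simple and for $\omega\subseteq\{1,\dots,s\}$, the ideal $I_A$ is called $T_\omega$-robust (for these choices) if its bouquet ideal is $I_T$ and $\omega=\{i: B_i\text{ is non-mixed}\}$. **Theorem.** Let $A_1,A_2$ be integer matrices with $n_1$, resp. $n_2$, columns such that $\mathrm{Ker}_{\mathbb Z}(A_j)\cap\mathbb N^{n_j}=\{0\}$ for $j=1,2$, and suppose that $I_{A_1}\subset K[x]$ and $I_{A_2}\subset K[y]$ are both $T_\omega$-robust, with corresponding maps $D_1$ and $D_2$.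 For a set $\mathcal S\subseteq K[x]$ put $$\mathcal S'=\{\,y^{D_2(u)^+}-y^{D_2(u)^-} : u\in\mathrm{Ker}_{\mathbb Z}(T),\ x^{D_1(u)^+}-x^{D_1(u)^-}\in\mathcal S\,\}.$$ 1. If $\mathcal G$ is the reduced Gröbner basis of $I_{A_1}$ with respect to a monomial order $<_1$, then there is a monomial order $<_2$ on $K[y]$ such that $\mathcal G'$ is the reduced Gröbner basis of $I_{A_2}$ with respect to $<_2$. Furthermore, there are finitely many $u_1,\dots,u_r\in\mathrm{Ker}_{\mathbb Z}(T)$ with $\mathrm{in}_{<_1}(I_{A_1})=(x^{D_1(u_1)^+},\dots,x^{D_1(u_r)^+})$; and for every set $U\subseteq\mathrm{Ker}_{\mathbb Z}(T)$ with $\mathrm{in}_{<_1}(I_{A_1})=(x^{D_1(u)^+}:u\in U)$ one has $\mathrm{in}_{<_2}(I_{A_2})=(y^{D_2(u)^+}:u\in U)$. 2. The map $\mathcal G\mapsto\mathcal G'$ is a bijection from the set of reduced Gröbner bases of $I_{A_1}$ (over all monomial orders) to that of $I_{A_2}$. 3. Let $\mathcal U_j$ be the universal Gröbner basis of $I_{A_j}$,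 i.e. the union of all its reduced Gröbner bases. Then $\mathcal U_2=\mathcal U_1'$, and there is a bijection $\mathcal U_1\to\mathcal U_2$ which sends $x^{D_1(u)^+}-x^{D_1(u)^-}$ to $y^{D_2(u)^+}-y^{D_2(u)^-}$ for every $u\in\mathrm{Ker}_{\mathbb Z}(T)$ such that the former lies in $\mathcal U_1$. -/

import Mathlib

open MvPolynomial

namespace ToricBouquet

noncomputable section

/-- The lattice `Ker_ℤ(A)` of an integer matrix `A` with `n` columns. -/
def kerZ {m n : ℕ} (A : Matrix (Fin m) (Fin n) ℤ) : Submodule ℤ (Fin n → ℤ) :=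
  LinearMap.ker A.mulVecLin

/-- `Ker_ℤ(A) ∩ ℕⁿ = {0}`. -/
def IsPositivelyGraded {m n : ℕ} (A : Matrix (Fin m) (Fin n) ℤ) : Prop :=
  ∀ u ∈ kerZ A, 0 ≤ u → u = 0

/-- The positive part `u⁺` of an integer vector, as an exponent vector. Since `Int.toNat` sends
negative integers to `0`, one has `u = u⁺ - u⁻` with `u⁻ = (-u)⁺`, and the supports are disjoint. -/
def posExp {n : ℕ} (u : Fin n → ℤ) : Fin n →₀ ℕ :=
  Finsupp.equivFunOnFinite.symm fun j => (u j).toNat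

/-- The negative part `u⁻` of an integer vector, as an exponent vector. -/
def negExp {n : ℕ} (u : Fin n → ℤ) : Fin n →₀ ℕ :=
  Finsupp.equivFunOnFinite.symm fun j => (-u j).toNat

/-- The binomial `x^{u⁺} - x^{u⁻}`. -/
def binom (K : Type*) [Field K] {n : ℕ} (u : Fin n → ℤ) : MvPolynomial (Fin n) K :=
  monomial (posExp u) 1 - monomial (negExp u) 1

/-- The toric ideal `I_A ⊆ K[x₁, …, xₙ]`, generated by the binomials `x^{u⁺} - x^{u⁻}` with
`u ∈ Ker_ℤ(A)`. -/
def toricIdeal (K : Type*) [Field K] {m n : ℕ} (A : Matrix (Fin m) (Fin n) ℤ) :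
    Ideal (MvPolynomial (Fin n) K) :=
  Ideal.span {f | ∃ u ∈ kerZ A, f = binom K u}

/-! ### Gröbner bases -/

/-- The initial ideal `in_<(I)`. (The leading term of `0` is `0`.) -/
def initialIdeal {K : Type*} [Field K] {n : ℕ} (ord : MonomialOrder (Fin n))
    (I : Ideal (MvPolynomial (Fin n) K)) : Ideal (MvPolynomial (Fin n) K) :=
  Ideal.span (ord.leadingTerm '' (I : Set (MvPolynomial (Fin n) K)))

/-- `G` is a Gröbner basis of `I` with respect to `ord`: a finite subset of `I` whose leading terms
generate the initial ideal. -/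
def IsGroebnerBasis {K : Type*} [Field K] {n : ℕ} (ord : MonomialOrder (Fin n))
    (G : Set (MvPolynomial (Fin n) K)) (I : Ideal (MvPolynomial (Fin n) K)) : Prop :=
  G.Finite ∧ G ⊆ I ∧ Ideal.span (ord.leadingTerm '' G) = initialIdeal ord I

/-- `G` is the reduced Gröbner basis of `I` with respect to `ord`: all its elements are monic, and
no monomial occurring in an element of `G` is divisible by the leading monomial of another element
of `G`. -/
def IsReducedGroebnerBasis {K : Type*} [Field K] {n : ℕ} (ord : MonomialOrder (Fin n))
    (G : Set (MvPolynomial (Fin n) K)) (I : Ideal (MvPolynomial (Fin n) K)) : Prop :=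
  IsGroebnerBasis ord G I ∧ (∀ g ∈ G, ord.Monic g) ∧
    ∀ g ∈ G, ∀ h ∈ G, h ≠ g → ∀ a ∈ g.support, ¬ ord.degree h ≤ a

/-- The set of all reduced Gröbner bases of `I`. For every monomial order there is one in the lowest
universe which compares monomials in the same way, so that universe suffices here. -/
def reducedGroebnerBases {K : Type*} [Field K] {n : ℕ} (I : Ideal (MvPolynomial (Fin n) K)) :
    Set (Set (MvPolynomial (Fin n) K)) :=
  {G | ∃ ord : MonomialOrder.{0, 0} (Fin n), IsReducedGroebnerBasis ord G I}

/-- The universal Gröbner basis of `I`: the union of all its reduced Gröbner bases. -/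
def universalGroebnerBasis {K : Type*} [Field K] {n : ℕ} (I : Ideal (MvPolynomial (Fin n) K)) :
    Set (MvPolynomial (Fin n) K) :=
  ⋃₀ reducedGroebnerBases I

/-! ### Bouquets -/

/-- The Gale transform of `A`: the columns form a basis of the lattice `Ker_ℤ(A)`, and the `j`-th
row is the vector `b_j`. (A different choice of basis multiplies the matrix on the right by a
unimodular matrix, which changes none of the notions below.) -/
def gale {m n : ℕ} (A : Matrix (Fin m) (Fin n) ℤ) :
    Matrix (Fin n) (Fin (Module.finrank ℤ (kerZ A))) ℤ :=
  Matrix.of fun j l => (Module.finBasis ℤ (kerZ A) l : Fin n → ℤ) j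

/-- `b_j = c b_k` for the rational number `c`. -/
def GaleRatio {m n : ℕ} (A : Matrix (Fin m) (Fin n) ℤ) (j k : Fin n) (c : ℚ) : Prop :=
  ∀ l, (gale A j l : ℚ) = c * (gale A k l : ℚ)

/-- The `j`-th column vector of `A` is free: `b_j = 0`. -/
def IsFree {m n : ℕ} (A : Matrix (Fin m) (Fin n) ℤ) (j : Fin n) : Prop :=
  gale A j = 0

/-- The bouquet graph of `A` on (the indices of) the columns of `A`: distinct `j`, `k` are adjacent
if each of `b_j`, `b_k` is a rational multiple of the other. -/
def bouquetGraph {m n : ℕ} (A : Matrix (Fin m) (Fin n) ℤ) : SimpleGraph (Fin n) where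
  Adj j k := j ≠ k ∧ (∃ c, GaleRatio A j k c) ∧ (∃ c, GaleRatio A k j c)
  symm := ⟨fun _ _ h => ⟨h.1.symm, h.2.2, h.2.1⟩⟩
  loopless := ⟨fun _ h => h.1 rfl⟩

/-- The toric ideal of `T` is simple: every bouquet is a singleton. -/
def IsSimple {p s : ℕ} (T : Matrix (Fin p) (Fin s) ℤ) : Prop :=
  ∀ j k, (bouquetGraph T).Reachable j k → j = k

/-- The choices made when the bouquets of `A` are written down: a numbering `B_1, …, B_s` of all the
bouquets (the connected components of the bouquet graph), the vector that comes first in each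
bouquet, and, for the free bouquet, an arbitrary integer vector with full support on the bouquet
whose first coordinate is positive (only the values of `freeVec` at free indices matter). -/
structure BouquetData {m n : ℕ} (A : Matrix (Fin m) (Fin n) ℤ) (s : ℕ) where
  label : (bouquetGraph A).ConnectedComponent ≃ Fin s
  first : Fin s → Fin n
  first_mem : ∀ i, label ((bouquetGraph A).connectedComponentMk (first i)) = i
  freeVec : Fin n → ℤ
  freeVec_ne_zero : ∀ j, IsFree A j → freeVec j ≠ 0
  freeVec_first_pos : ∀ i, IsFree A (first i) → 0 < freeVec (first i)

namespace BouquetData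

variable {m n s : ℕ} {A : Matrix (Fin m) (Fin n) ℤ} (B : BouquetData A s)

open Classical in
/-- The bouquet `B_i`, as a set of indices of columns of `A`. -/
def bouquet (i : Fin s) : Finset (Fin n) :=
  Finset.univ.filter fun j => B.label ((bouquetGraph A).connectedComponentMk j) = i

/-- The bouquet `B_i` is non-mixed: it is not free, and along each of its edges the rows of the Gale
transform are positive multiples of each other. -/
def IsNonMixed (i : Fin s) : Prop :=
  (∀ j ∈ B.bouquet i, ¬ IsFree A j) ∧
    ∀ j ∈ B.bouquet i, ∀ k ∈ B.bouquet i, (bouquetGraph A).Adj j k →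
      ∀ c, GaleRatio A j k c → 0 < c

open Classical in
/-- The vector `c_{B_i} ∈ ℤⁿ`, supported on `B_i`. If `B_i` is not free, there is a coordinate `l` at
which all the `b_j`, `j ∈ B_i`, are nonzero; then `(c_{B_i})_j = ε (b_j)_l / g`, where `g` is the gcd
of the `(b_k)_l`, `k ∈ B_i`, and `ε` is the sign of `(b_{first i})_l` (this is independent of `l`).
If `B_i` is free, there is no such `l`, and the chosen vector is used. -/
def cVec (i : Fin s) : Fin n → ℤ := fun j =>
  if j ∈ B.bouquet i then
    if h : ∃ l, ∀ k ∈ B.bouquet i, gale A k l ≠ 0 then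
      (gale A (B.first i) h.choose).sign *
        (gale A j h.choose / (B.bouquet i).gcd fun k => gale A k h.choose)
    else B.freeVec j
  else 0

/-- The matrix `A_B` whose `i`-th column is `a_{B_i} = ∑_j (c_{B_i})_j a_j`. Its toric ideal is the
bouquet ideal of `A`. -/
def bouquetMatrix : Matrix (Fin m) (Fin s) ℤ :=
  Matrix.of fun r i => ∑ j, B.cVec i j * A r j

/-- The map `D(u) = c_{B_1} u_1 + ⋯ + c_{B_s} u_s`. -/
def D (u : Fin s → ℤ) : Fin n → ℤ :=
  ∑ i, u i • B.cVec i

/-- `I_A` is `T_ω`-robust (with respect to the chosen numbering of its bouquets): its bouquet ideal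
is `I_T`, and `ω` is the set of indices of the non-mixed bouquets. -/
def IsRobust (K : Type*) [Field K] {p : ℕ} (T : Matrix (Fin p) (Fin s) ℤ) (ω : Set (Fin s)) :
    Prop :=
  toricIdeal K B.bouquetMatrix = toricIdeal K T ∧ ω = {i | B.IsNonMixed i}

end BouquetData

/-- For a set `S` of polynomials, the set of all `y^{D₂(u)⁺} - y^{D₂(u)⁻}` where `u ∈ Ker_ℤ(T)` is
such that `x^{D₁(u)⁺} - x^{D₁(u)⁻} ∈ S`. -/
def transfer (K : Type*) [Field K] {p s n₁ n₂ : ℕ} (T : Matrix (Fin p) (Fin s) ℤ)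
    (D₁ : (Fin s → ℤ) → (Fin n₁ → ℤ)) (D₂ : (Fin s → ℤ) → (Fin n₂ → ℤ))
    (S : Set (MvPolynomial (Fin n₁) K)) : Set (MvPolynomial (Fin n₂) K) :=
  {g | ∃ u ∈ kerZ T, binom K (D₁ u) ∈ S ∧ g = binom K (D₂ u)}

/-- The monomial ideal generated by the `x^{D(u)⁺}` with `u ∈ U`. -/
def posMonomialIdeal (K : Type*) [Field K] {s n : ℕ} (D : (Fin s → ℤ) → (Fin n → ℤ))
    (U : Set (Fin s → ℤ)) : Ideal (MvPolynomial (Fin n) K) :=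
  Ideal.span ((fun u => monomial (posExp (D u)) (1 : K)) '' U)

end

end ToricBouquet

open ToricBouquet

/-!
The toric ideal `I_A` is generated by the binomials of its lattice `Ker_ℤ(A)`, and for every
monomial order its reduced Gröbner basis consists of the binomials `x^{v⁺} - x^{v⁻}`, `v ∈
Ker_ℤ(A)`, for which `x^{v⁺}` is the larger monomial and a minimal generator of the initial ideal,
and `x^{v⁻}` is a standard monomial (`isReducedGroebnerBasis_iff`). So the basis can be read off
from two pieces of data on the lattice: which vectors `v` are positive (`x^{v⁺} > x^{v⁻}`), and for
which pairs the monomial `x^{v⁺}` divides `x^{w⁺}`.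

The map `D` is an isomorphism from the lattice of the bouquet matrix onto `Ker_ℤ(A)`: on each
bouquet a lattice vector is proportional to the primitive vector `c_{B_i}`
(`BouquetData.exists_D_eq`). Since a toric ideal determines its lattice, for a `T_ω`-robust ideal
`D` is defined on `Ker_ℤ(T)`. There the divisibility of `x^{D(w)⁺}` by `x^{D(u)⁺}` is governed by
`ω` alone: at `i ∈ ω` only the positive parts of `u_i` and `w_i` are compared, at `i ∉ ω` also the
negative parts (`BouquetData.posExp_D_le_iff`). Hence the second piece of data is the same for `A₁`
and `A₂`.

As for the first, the vectors `D₂(u)` with `D₁(u)` positive form a pointed cone in `Ker_ℤ(A₂)`.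
Since that lattice contains no nonzero nonnegative vector, the cone stays pointed after adjoining
the nonnegative vectors, and a maximal pointed cone containing it is the nonnegative cone of a
total group order (`exists_total_cone`), which is a well-order on exponent vectors by Dickson's
lemma. This gives a monomial order `<₂` that agrees with `<₁` on `Ker_ℤ(T)`
(`exists_ordersCompatible`), and the reduced Gröbner bases and initial ideals correspond. The
construction is symmetric in `A₁` and `A₂`, so the transfer in the other direction is the inverse
map; the universal Gröbner bases correspond as unions.
-/

namespace ToricBouquet

/-! ### Exponent vectors and integer vectors -/

/-- The difference `a - b` of two exponent vectors, as an integer vector. -/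
def diffVec {n : ℕ} (a b : Fin n →₀ ℕ) : Fin n → ℤ := fun j => (a j : ℤ) - b j

section Exponents

variable {n : ℕ}

@[simp]
lemma posExp_apply (v : Fin n → ℤ) (j : Fin n) : posExp v j = (v j).toNat := rfl

@[simp]
lemma negExp_apply (v : Fin n → ℤ) (j : Fin n) : negExp v j = (-v j).toNat := rfl

@[simp]
lemma diffVec_apply (a b : Fin n →₀ ℕ) (j : Fin n) : diffVec a b j = (a j : ℤ) - b j := rfl

lemma posExp_neg (v : Fin n → ℤ) : posExp (-v) = negExp v := rfl

lemma negExp_neg (v : Fin n → ℤ) : negExp (-v) = posExp v := by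
  ext j
  simp

lemma diffVec_posExp_negExp (v : Fin n → ℤ) : diffVec (posExp v) (negExp v) = v := by
  ext j
  simp only [diffVec_apply, posExp_apply, negExp_apply]
  omega

lemma diffVec_self (a : Fin n →₀ ℕ) : diffVec a a = 0 := by
  ext j
  simp

lemma eq_of_diffVec_eq_zero {a b : Fin n →₀ ℕ} (h : diffVec a b = 0) : a = b := by
  ext j
  have := congrFun h j
  simp only [diffVec_apply, Pi.zero_apply] at this
  omega

lemma posExp_diffVec_le (a b : Fin n →₀ ℕ) : posExp (diffVec a b) ≤ a := by
  intro j
  simp only [diffVec_apply, posExp_apply]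
  omega

/-- The exponents `v⁺ + b` and `v⁻ + a` agree for `v = a - b`. -/
lemma posExp_diffVec_add (a b : Fin n →₀ ℕ) :
    posExp (diffVec a b) + b = negExp (diffVec a b) + a := by
  ext j
  simp only [Finsupp.add_apply, diffVec_apply, posExp_apply, negExp_apply]
  omega

lemma posExp_add_add (v w : Fin n → ℤ) :
    posExp (v + w) + (negExp v + negExp w) = negExp (v + w) + (posExp v + posExp w) := by
  ext j
  simp only [Finsupp.add_apply, Pi.add_apply, posExp_apply, negExp_apply]
  omega

lemma eq_of_posExp_eq_of_negExp_eq {v w : Fin n → ℤ} (hp : posExp v = posExp w)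
    (hn : negExp v = negExp w) : v = w := by
  rw [← diffVec_posExp_negExp v, ← diffVec_posExp_negExp w, hp, hn]

lemma eq_zero_of_posExp_eq_negExp {v : Fin n → ℤ} (h : posExp v = negExp v) : v = 0 := by
  rw [← diffVec_posExp_negExp v, h, diffVec_self]

end Exponents

/-! ### The comparison of the two monomials of a binomial -/

/-- The integer vector `v` is positive for the monomial order: `x^{v⁺}` is larger than `x^{v⁻}`.
These are the positive elements of a total group order on `ℤⁿ`. -/
def IsPos {n : ℕ} (ord : MonomialOrder (Fin n)) (v : Fin n → ℤ) : Prop :=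
  ord.toSyn (negExp v) < ord.toSyn (posExp v)

section IsPos

variable {n : ℕ} {ord : MonomialOrder (Fin n)}

lemma isPos_diffVec_iff {a b : Fin n →₀ ℕ} :
    IsPos ord (diffVec a b) ↔ ord.toSyn b < ord.toSyn a := by
  have h := congrArg ord.toSyn (posExp_diffVec_add a b)
  rw [map_add, map_add] at h
  unfold IsPos
  constructor
  · intro hv
    by_contra hab
    exact absurd h (add_lt_add_of_lt_of_le hv (not_lt.mp hab)).ne'
  · intro hab
    by_contra hv
    exact absurd h (add_lt_add_of_le_of_lt (not_lt.mp hv) hab).ne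

lemma IsPos.add {v w : Fin n → ℤ} (hv : IsPos ord v) (hw : IsPos ord w) : IsPos ord (v + w) := by
  have h := congrArg ord.toSyn (posExp_add_add v w)
  simp only [map_add] at h
  by_contra hvw
  exact absurd h (add_lt_add_of_le_of_lt (not_lt.mp hvw) (add_lt_add hv hw)).ne

lemma not_isPos_zero : ¬ IsPos ord (0 : Fin n → ℤ) := by
  have h : negExp (0 : Fin n → ℤ) = posExp 0 := by
    ext j
    simp
  simp [IsPos, h]

lemma IsPos.ne_zero {v : Fin n → ℤ} (hv : IsPos ord v) : v ≠ 0 := by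
  rintro rfl
  exact not_isPos_zero hv

lemma isPos_or_isPos_neg {v : Fin n → ℤ} (hv : v ≠ 0) : IsPos ord v ∨ IsPos ord (-v) := by
  unfold IsPos
  rw [posExp_neg, negExp_neg]
  refine lt_or_gt_of_ne fun h => hv ?_
  exact eq_zero_of_posExp_eq_negExp (ord.toSyn.injective h).symm

lemma IsPos.not_neg {v : Fin n → ℤ} (hv : IsPos ord v) : ¬ IsPos ord (-v) := by
  unfold IsPos
  rw [posExp_neg, negExp_neg]
  exact lt_asymm hv

end IsPos

/-! ### Binomials and the toric ideal -/

section Toric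

variable {K : Type*} [Field K] {m n : ℕ} {A : Matrix (Fin m) (Fin n) ℤ}

lemma binom_eq_binom_iff {v w : Fin n → ℤ} :
    binom K v = binom K w ↔ v = w ∨ v = -w ∧ (2 : K) = 0 := by
  classical
  constructor
  · intro h
    by_cases hv : v = 0
    · subst hv
      left
      have h0 : binom K (0 : Fin n → ℤ) = 0 := by
        have h : negExp (0 : Fin n → ℤ) = posExp 0 := by
          ext j
          simp
        simp [binom, h]
      rw [h0] at h
      refine (eq_zero_of_posExp_eq_negExp ?_).symm
      have h' := (sub_eq_zero.mp h.symm)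
      exact (monomial_left_injective (one_ne_zero (α := K))) h'
    · have hne : posExp v ≠ negExp v := fun h => hv (eq_zero_of_posExp_eq_negExp h)
      have hp := congrArg (coeff (posExp v)) h
      have hn := congrArg (coeff (negExp v)) h
      simp only [binom, coeff_sub, coeff_monomial, hne, hne.symm, if_true, if_false] at hp hn
      by_cases h1 : posExp w = posExp v
      · by_cases h2 : negExp w = posExp v
        · simp [h1, h2] at hp
        · by_cases h3 : negExp w = negExp v
          · exact .inl (eq_of_posExp_eq_of_negExp_eq h1.symm h3.symm)
          · simp [h1, hne, h3] at hn
      · by_cases h2 : negExp w = posExp v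
        · have h20 : (2 : K) = 0 := by
            simp only [h1, h2, if_true, if_false] at hp
            linear_combination hp
          by_cases h3 : posExp w = negExp v
          · refine .inr ⟨eq_of_posExp_eq_of_negExp_eq ?_ ?_, h20⟩
            · rw [posExp_neg, h2]
            · rw [negExp_neg, h3]
          · simp [h3, h2, hne] at hn
        · simp [h1, h2] at hp
  · rintro (rfl | ⟨rfl, h2⟩)
    · rfl
    · unfold binom
      rw [posExp_neg, negExp_neg, ← neg_sub]
      have : ∀ f : MvPolynomial (Fin n) K, -f = f := by
        intro f
        have hf : (C (2 : K)) * f = 0 := by rw [h2, map_zero, zero_mul]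
        rw [map_ofNat] at hf
        linear_combination -hf
      exact this _

lemma binom_mem_toricIdeal {v : Fin n → ℤ} (hv : v ∈ kerZ A) : binom K v ∈ toricIdeal K A :=
  Ideal.subset_span ⟨v, hv, rfl⟩

variable (K A) in
/-- The homomorphism `x_j ↦ t^{a_j}` to the ring of Laurent polynomials, which is the group algebra
of `ℤᵐ`. Its kernel is the toric ideal. -/
noncomputable def toricHom : MvPolynomial (Fin n) K →ₐ[K] AddMonoidAlgebra K (Fin m → ℤ) :=
  aeval fun j => AddMonoidAlgebra.single (fun r => A r j) 1

lemma toricHom_monomial (a : Fin n →₀ ℕ) (c : K) :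
    toricHom K A (monomial a c) = AddMonoidAlgebra.single (A.mulVec fun j => (a j : ℤ)) c := by
  rw [toricHom, aeval_monomial, Finsupp.prod_fintype _ _ (by simp)]
  simp only [AddMonoidAlgebra.single_pow, one_pow]
  have h : ∀ s : Finset (Fin n), ∏ j ∈ s, AddMonoidAlgebra.single (a j • fun r => A r j) (1 : K)
      = AddMonoidAlgebra.single (∑ j ∈ s, a j • fun r => A r j) 1 := by
    intro s
    induction s using Finset.induction_on with
    | empty => rfl
    | insert j s hj ih =>
      rw [Finset.prod_insert hj, Finset.sum_insert hj, ih, AddMonoidAlgebra.single_mul_single,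
        one_mul]
  rw [h, AddMonoidAlgebra.coe_algebraMap, Function.comp_apply, Algebra.algebraMap_self_apply,
    AddMonoidAlgebra.single_mul_single, zero_add, mul_one]
  congr 1
  ext r
  simp [Matrix.mulVec, dotProduct, mul_comm]

lemma mulVec_eq_iff_diffVec_mem_kerZ {a b : Fin n →₀ ℕ} :
    (A.mulVec fun j => (a j : ℤ)) = (A.mulVec fun j => (b j : ℤ)) ↔ diffVec a b ∈ kerZ A := by
  have h : diffVec a b = (fun j => (a j : ℤ)) - fun j => (b j : ℤ) := rfl
  rw [kerZ, LinearMap.mem_ker, Matrix.mulVecLin_apply, h, Matrix.mulVec_sub, sub_eq_zero]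

lemma toricHom_eq_zero_of_mem {f : MvPolynomial (Fin n) K} (hf : f ∈ toricIdeal K A) :
    toricHom K A f = 0 := by
  have h : toricIdeal K A ≤ RingHom.ker (toricHom K A) := by
    refine Ideal.span_le.mpr ?_
    rintro _ ⟨v, hv, rfl⟩
    rw [SetLike.mem_coe, RingHom.mem_ker, binom, map_sub, toricHom_monomial, toricHom_monomial,
      mulVec_eq_iff_diffVec_mem_kerZ.mpr (by rwa [diffVec_posExp_negExp]), sub_self]
  exact h hf

/-- In an element of the toric ideal no monomial is alone in its `A`-degree, since the coefficients
of the monomials of any given `A`-degree add up to zero. -/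
lemma exists_mem_support_diffVec_mem_kerZ {f : MvPolynomial (Fin n) K} (hf : f ∈ toricIdeal K A)
    {a : Fin n →₀ ℕ} (ha : a ∈ f.support) :
    ∃ b ∈ f.support, b ≠ a ∧ diffVec a b ∈ kerZ A := by
  classical
  by_contra! hcon
  have h0 := toricHom_eq_zero_of_mem hf
  rw [f.as_sum, map_sum] at h0
  have h1 := congrArg (fun F => F.coeff (A.mulVec fun j => (a j : ℤ))) h0
  simp only [toricHom_monomial, AddMonoidAlgebra.coeff_sum, Finsupp.finsetSum_apply,
    AddMonoidAlgebra.coeff_single, AddMonoidAlgebra.coeff_zero, Finsupp.zero_apply] at h1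
  rw [Finset.sum_eq_single_of_mem a ha, Finsupp.single_eq_same] at h1
  · exact mem_support_iff.mp ha h1
  · intro b hb hba
    refine Finsupp.single_eq_of_ne fun h => hcon b hb hba ?_
    exact mulVec_eq_iff_diffVec_mem_kerZ.mp h

lemma binom_mem_toricIdeal_iff {v : Fin n → ℤ} : binom K v ∈ toricIdeal K A ↔ v ∈ kerZ A := by
  refine ⟨fun h => ?_, binom_mem_toricIdeal⟩
  have h0 := toricHom_eq_zero_of_mem h
  rw [binom, map_sub, toricHom_monomial, toricHom_monomial, sub_eq_zero] at h0
  rw [← diffVec_posExp_negExp v, ← mulVec_eq_iff_diffVec_mem_kerZ]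
  exact Finsupp.single_left_injective (one_ne_zero (α := K))
    (congrArg AddMonoidAlgebra.coeff h0)

/-- The lattice of a matrix is determined by its toric ideal. -/
lemma kerZ_eq_of_toricIdeal_eq {m' : ℕ} {A' : Matrix (Fin m') (Fin n) ℤ}
    (h : toricIdeal K A = toricIdeal K A') : kerZ A = kerZ A' := by
  ext v
  rw [← binom_mem_toricIdeal_iff (K := K), h, binom_mem_toricIdeal_iff]

end Toric

/-! ### Reduced Gröbner bases of toric ideals -/

/-- The vectors `v ∈ Ker_ℤ(A)` whose binomials make up the reduced Gröbner basis of the toric ideal: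
`x^{v⁺}` is the leading monomial and a minimal generator of the initial ideal, and `x^{v⁻}` is a
standard monomial. -/
def reducedVectors {m n : ℕ} (ord : MonomialOrder (Fin n)) (A : Matrix (Fin m) (Fin n) ℤ) :
    Set (Fin n → ℤ) :=
  {v | v ∈ kerZ A ∧ IsPos ord v ∧
    (∀ w ∈ kerZ A, IsPos ord w → posExp w ≤ posExp v → posExp v ≤ posExp w) ∧
    ∀ w ∈ kerZ A, IsPos ord w → ¬ posExp w ≤ negExp v}

section Groebner

variable {K : Type*} [Field K] {m n : ℕ} {A : Matrix (Fin m) (Fin n) ℤ}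
  {ord : MonomialOrder (Fin n)}

lemma exists_isPos_posExp_le_degree {f : MvPolynomial (Fin n) K} (hf : f ∈ toricIdeal K A)
    (h0 : f ≠ 0) : ∃ v ∈ kerZ A, IsPos ord v ∧ posExp v ≤ ord.degree f := by
  obtain ⟨b, hb, hne, hmem⟩ :=
    exists_mem_support_diffVec_mem_kerZ hf (ord.degree_mem_support h0)
  refine ⟨_, hmem, isPos_diffVec_iff.mpr ?_, posExp_diffVec_le _ _⟩
  exact lt_of_le_of_ne (ord.le_degree hb) fun h => hne (ord.toSyn.injective h)

lemma eq_zero_of_forall_support {f : MvPolynomial (Fin n) K} (hf : f ∈ toricIdeal K A)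
    (h : ∀ a ∈ f.support, ∀ v ∈ kerZ A, IsPos ord v → ¬ posExp v ≤ a) : f = 0 := by
  by_contra h0
  obtain ⟨v, hv, hpos, hle⟩ := exists_isPos_posExp_le_degree (ord := ord) hf h0
  exact h _ (ord.degree_mem_support h0) v hv hpos hle

lemma coeff_posExp_binom {v : Fin n → ℤ} (hv : IsPos ord v) : coeff (posExp v) (binom K v) = 1 := by
  classical
  have hne : negExp v ≠ posExp v := fun h => by
    unfold IsPos at hv
    rw [h] at hv
    exact lt_irrefl _ hv
  simp [binom, coeff_monomial, hne]

lemma binom_ne_zero {v : Fin n → ℤ} (hv : IsPos ord v) : binom K v ≠ 0 := by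
  intro h
  have := coeff_posExp_binom (K := K) hv
  simp [h] at this

lemma eq_or_eq_of_mem_support_binom {v : Fin n → ℤ} {a : Fin n →₀ ℕ}
    (ha : a ∈ (binom K v).support) : a = posExp v ∨ a = negExp v := by
  classical
  rw [mem_support_iff, binom, coeff_sub, coeff_monomial, coeff_monomial] at ha
  by_contra! h
  simp [h.1.symm, h.2.symm] at ha

lemma degree_binom {v : Fin n → ℤ} (hv : IsPos ord v) :
    ord.degree (binom K v) = posExp v := by
  have hp : posExp v ∈ (binom K v).support := by
    rw [mem_support_iff, coeff_posExp_binom hv]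
    exact one_ne_zero
  rcases eq_or_eq_of_mem_support_binom (ord.degree_mem_support (binom_ne_zero (K := K) hv))
    with h | h
  · exact h
  · have := ord.le_degree hp
    rw [h] at this
    exact absurd hv this.not_gt

lemma monic_binom {v : Fin n → ℤ} (hv : IsPos ord v) : ord.Monic (binom K v) := by
  rw [MonomialOrder.Monic, MonomialOrder.leadingCoeff, degree_binom hv, coeff_posExp_binom hv]

lemma leadingTerm_binom {v : Fin n → ℤ} (hv : IsPos ord v) :
    ord.leadingTerm (binom K v) = monomial (posExp v) 1 := by
  rw [MonomialOrder.leadingTerm, degree_binom hv, (monic_binom hv).leadingCoeff_eq_one]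

/-- The initial ideal of the toric ideal is generated by the monomials `x^{v⁺}`, where `v` runs
through the positive vectors of the lattice. -/
lemma initialIdeal_toricIdeal :
    initialIdeal ord (toricIdeal K A) =
      Ideal.span ((fun a => monomial a (1 : K)) '' (posExp '' {v | v ∈ kerZ A ∧ IsPos ord v})) := by
  classical
  refine le_antisymm (Ideal.span_le.mpr ?_) (Ideal.span_le.mpr ?_)
  · rintro _ ⟨f, hf, rfl⟩
    rw [SetLike.mem_coe, mem_ideal_span_monomial_image]
    intro a ha
    have h0 : f ≠ 0 := by
      rintro rfl
      simp at ha
    rw [ord.support_leadingTerm' h0, Finset.mem_singleton] at ha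
    obtain ⟨v, hv, hpos, hle⟩ := exists_isPos_posExp_le_degree (ord := ord) hf h0
    exact ⟨_, ⟨v, ⟨hv, hpos⟩, rfl⟩, ha ▸ hle⟩
  · rintro _ ⟨_, ⟨v, ⟨hv, hpos⟩, rfl⟩, rfl⟩
    exact Ideal.subset_span ⟨_, binom_mem_toricIdeal hv, leadingTerm_binom hpos⟩

lemma monomial_mem_initialIdeal_iff {a : Fin n →₀ ℕ} :
    monomial a (1 : K) ∈ initialIdeal ord (toricIdeal K A) ↔
      ∃ v ∈ kerZ A, IsPos ord v ∧ posExp v ≤ a := by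
  classical
  rw [initialIdeal_toricIdeal, mem_ideal_span_monomial_image, support_monomial,
    if_neg one_ne_zero]
  simp [and_assoc]

/-- Among the positive lattice vectors `v` with a given minimal `v⁺`, the one with the smallest `v⁻`
has a standard monomial `x^{v⁻}`: otherwise `v⁻` could be reduced further. -/
lemma exists_mem_reducedVectors_posExp_eq {v : Fin n → ℤ} (hv : v ∈ kerZ A) (hpos : IsPos ord v)
    (hmin : ∀ w ∈ kerZ A, IsPos ord w → posExp w ≤ posExp v → posExp v ≤ posExp w) :
    ∃ w ∈ reducedVectors ord A, posExp w = posExp v := by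
  obtain ⟨w, ⟨hw, hwpos, hwv⟩, hleast⟩ := (InvImage.wf (fun w : Fin n → ℤ => ord.toSyn (negExp w))
    (wellFounded_lt (α := ord.syn))).has_min
      {w | w ∈ kerZ A ∧ IsPos ord w ∧ posExp w = posExp v} ⟨v, hv, hpos, rfl⟩
  refine ⟨w, ⟨hw, hwpos, by rwa [hwv], fun z hz hzpos hle => ?_⟩, hwv⟩
  -- One reduction step replaces the exponent `w⁻` by the smaller exponent `b = w⁻ - z⁺ + z⁻`.
  set b : Fin n →₀ ℕ := negExp w - posExp z + negExp z with hb
  have hbj : ∀ j, (b j : ℤ) = (negExp w j : ℤ) - z j := by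
    intro j
    have := hle j
    simp only [hb, Finsupp.add_apply, Finsupp.tsub_apply, posExp_apply, negExp_apply] at this ⊢
    omega
  have hdiff : diffVec (posExp w) b = w + z := by
    ext j
    rw [diffVec_apply, hbj, Pi.add_apply, posExp_apply, negExp_apply]
    omega
  have hlt : ord.toSyn b < ord.toSyn (negExp w) := by
    rw [← isPos_diffVec_iff]
    convert hzpos using 1
    ext j
    rw [diffVec_apply, hbj]
    ring
  have hpos' : IsPos ord (w + z) := hwpos.add hzpos
  have hle' : posExp (w + z) ≤ posExp v := by
    rw [← hdiff, ← hwv]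
    exact posExp_diffVec_le _ _
  have heq : posExp (w + z) = posExp v :=
    le_antisymm hle' (hmin _ (add_mem hw hz) hpos' hle')
  have hneg : negExp (w + z) = b := by
    have h := posExp_diffVec_add (posExp w) b
    rw [hdiff, heq, hwv, add_comm] at h
    exact (add_right_cancel h).symm
  exact hleast _ ⟨add_mem hw hz, hpos', heq⟩ (by rwa [← hneg] at hlt)

lemma exists_mem_reducedVectors_posExp_le {v : Fin n → ℤ} (hv : v ∈ kerZ A) (hpos : IsPos ord v) :
    ∃ w ∈ reducedVectors ord A, posExp w ≤ posExp v := by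
  obtain ⟨w, ⟨hw, hwpos, hwv⟩, hmin⟩ := (InvImage.wf (posExp (n := n))
    (wellFounded_lt (α := Fin n →₀ ℕ))).has_min
      {w | w ∈ kerZ A ∧ IsPos ord w ∧ posExp w ≤ posExp v} ⟨v, hv, hpos, le_rfl⟩
  obtain ⟨z, hz, hzw⟩ := exists_mem_reducedVectors_posExp_eq hw hwpos fun z hz hzpos hle => by
    by_contra hlt
    exact hmin z ⟨hz, hzpos, hle.trans hwv⟩ (lt_of_le_not_ge hle hlt)
  exact ⟨z, hz, hzw.trans_le hwv⟩

lemma eq_of_mem_reducedVectors {v w : Fin n → ℤ} (hv : v ∈ reducedVectors ord A)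
    (hw : w ∈ reducedVectors ord A) (h : posExp v ≤ posExp w) : v = w := by
  classical
  have heq : posExp v = posExp w := le_antisymm h (hw.2.2.1 v hv.1 hv.2.1 h)
  by_contra hne
  -- The lattice vector `v - w = w⁻ - v⁻` or its negative is positive, so that one of the two
  -- standard monomials would lie in the initial ideal.
  have hd : diffVec (negExp w) (negExp v) = v - w := by
    ext j
    have := DFunLike.congr_fun heq j
    simp only [diffVec_apply, Pi.sub_apply, posExp_apply, negExp_apply] at this ⊢
    omega
  have hd' : diffVec (negExp v) (negExp w) = -(v - w) := by
    rw [← hd]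
    ext j
    simp
  rcases isPos_or_isPos_neg (ord := ord) (sub_ne_zero.mpr hne) with hp | hp
  · exact hw.2.2.2 _ (sub_mem hv.1 hw.1) hp (hd ▸ posExp_diffVec_le _ _)
  · exact hv.2.2.2 _ (neg_mem (sub_mem hv.1 hw.1)) hp (hd' ▸ posExp_diffVec_le _ _)

lemma finite_reducedVectors : (reducedVectors ord A).Finite := by
  have hanti : IsAntichain (· ≤ ·) (posExp '' reducedVectors ord A) := by
    rintro _ ⟨v, hv, rfl⟩ _ ⟨w, hw, rfl⟩ hne hle
    exact hne (by rw [eq_of_mem_reducedVectors hv hw hle])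
  refine (WellQuasiOrderedLE.finite_of_isAntichain hanti).of_finite_image ?_
  exact fun v hv w hw h => eq_of_mem_reducedVectors hv hw h.le

lemma isReducedGroebnerBasis_binom_image :
    IsReducedGroebnerBasis ord (binom K '' reducedVectors ord A) (toricIdeal K A) := by
  classical
  refine ⟨⟨finite_reducedVectors.image _, ?_, ?_⟩, ?_, ?_⟩
  · rintro _ ⟨v, hv, rfl⟩
    exact binom_mem_toricIdeal hv.1
  · refine le_antisymm (Ideal.span_mono (Set.image_mono ?_)) ?_
    · rintro _ ⟨v, hv, rfl⟩
      exact binom_mem_toricIdeal hv.1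
    · rw [initialIdeal_toricIdeal]
      refine Ideal.span_le.mpr ?_
      rintro _ ⟨_, ⟨v, ⟨hv, hpos⟩, rfl⟩, rfl⟩
      obtain ⟨w, hw, hle⟩ := exists_mem_reducedVectors_posExp_le hv hpos
      refine Ideal.mem_of_dvd _ ?_
        (Ideal.subset_span ⟨_, ⟨w, hw, rfl⟩, leadingTerm_binom hw.2.1⟩)
      exact monomial_dvd_monomial.mpr ⟨.inr hle, dvd_rfl⟩
  · rintro _ ⟨v, hv, rfl⟩
    exact monic_binom hv.2.1
  · rintro _ ⟨v, hv, rfl⟩ _ ⟨w, hw, rfl⟩ hne a ha hle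
    rw [degree_binom hw.2.1] at hle
    rcases eq_or_eq_of_mem_support_binom ha with rfl | rfl
    · exact hne (by rw [eq_of_mem_reducedVectors hw hv hle])
    · exact hv.2.2.2 w hw.1 hw.2.1 hle

/-- The reduced Gröbner basis is unique. -/
lemma isReducedGroebnerBasis_iff {G : Set (MvPolynomial (Fin n) K)} :
    IsReducedGroebnerBasis ord G (toricIdeal K A) ↔ G = binom K '' reducedVectors ord A := by
  classical
  refine ⟨fun hG => ?_, fun h => h ▸ isReducedGroebnerBasis_binom_image⟩
  obtain ⟨⟨-, hsub, hspan⟩, hmonic, hred⟩ := hG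
  have hlead : ∀ a : Fin n →₀ ℕ, (∃ v ∈ kerZ A, IsPos ord v ∧ posExp v ≤ a) →
      ∃ h ∈ G, ord.degree h ≤ a := by
    intro a ha
    rw [← monomial_mem_initialIdeal_iff (K := K), ← hspan] at ha
    have himg : ord.leadingTerm '' G = (fun a => monomial a (1 : K)) '' (ord.degree '' G) := by
      rw [Set.image_image]
      refine Set.image_congr fun g hg => ?_
      rw [MonomialOrder.leadingTerm, (hmonic g hg).leadingCoeff_eq_one]
    rw [himg, mem_ideal_span_monomial_image, support_monomial, if_neg one_ne_zero] at ha
    simpa using ha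
  -- Every `g ∈ G` is the binomial of the reduced vector `v` with `v⁺` the degree of `g`, since the
  -- difference of the two is an element of the ideal without monomials in the initial ideal.
  have hmem : ∀ g ∈ G, ∃ v ∈ reducedVectors ord A, g = binom K v := by
    intro g hg
    have hg0 : g ≠ 0 := (hmonic g hg).ne_zero
    have hdeg := ord.degree_mem_support hg0
    have hmin : ∀ w ∈ kerZ A, IsPos ord w → posExp w ≤ ord.degree g →
        ord.degree g ≤ posExp w := by
      intro w hw hwpos hle
      obtain ⟨h, hh, hle'⟩ := hlead _ ⟨w, hw, hwpos, le_rfl⟩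
      by_cases hhg : h = g
      · rwa [hhg] at hle'
      · exact absurd (hle'.trans hle) (hred g hg h hh hhg _ hdeg)
    have hstd : ∀ a ∈ g.support, a ≠ ord.degree g →
        ∀ w ∈ kerZ A, IsPos ord w → ¬ posExp w ≤ a := by
      intro a ha hne w hw hwpos hle
      obtain ⟨h, hh, hle'⟩ := hlead a ⟨w, hw, hwpos, hle⟩
      by_cases hhg : h = g
      · rw [hhg] at hle'
        exact hne (ord.toSyn.injective (le_antisymm (ord.le_degree ha) (ord.toSyn_monotone hle')))
      · exact hred g hg h hh hhg a ha hle'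
    obtain ⟨v₀, hv₀, hpos₀, hle₀⟩ := exists_isPos_posExp_le_degree (ord := ord) (hsub hg) hg0
    have heq₀ := le_antisymm hle₀ (hmin v₀ hv₀ hpos₀ hle₀)
    obtain ⟨v, hv, hvv₀⟩ := exists_mem_reducedVectors_posExp_eq hv₀ hpos₀ (by rwa [heq₀])
    have heq : posExp v = ord.degree g := hvv₀.trans heq₀
    refine ⟨v, hv, sub_eq_zero.mp (eq_zero_of_forall_support (ord := ord)
      (sub_mem (hsub hg) (binom_mem_toricIdeal hv.1)) fun a ha => ?_)⟩
    have hane : a ≠ ord.degree g := by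
      rintro rfl
      rw [mem_support_iff, coeff_sub, ← heq, coeff_posExp_binom hv.2.1, heq] at ha
      exact ha (sub_eq_zero.mpr (hmonic g hg))
    rcases Finset.mem_union.mp (support_sub _ _ _ ha) with h | h
    · exact hstd a h hane
    · rcases eq_or_eq_of_mem_support_binom h with rfl | rfl
      · exact absurd heq hane
      · exact hv.2.2.2
  ext g
  constructor
  · intro hg
    obtain ⟨v, hv, rfl⟩ := hmem g hg
    exact ⟨v, hv, rfl⟩
  · rintro ⟨v, hv, rfl⟩
    obtain ⟨h, hh, hle⟩ := hlead _ ⟨v, hv.1, hv.2.1, le_rfl⟩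
    obtain ⟨w, hw, rfl⟩ := hmem h hh
    rw [degree_binom hw.2.1] at hle
    rwa [← eq_of_mem_reducedVectors hw hv hle]

end Groebner

/-! ### Extending a positive cone to a monomial order -/

/-- In a torsion-free abelian group every pointed cone is contained in the nonnegative cone of a
total order: a maximal pointed cone is total, since for `a` outside `P ∪ -P` the cone generated by
`P` and `a` is still pointed. -/
lemma exists_total_cone {G : Type*} [AddCommGroup G] [IsAddTorsionFree G] (P₀ : AddSubmonoid G)
    (h₀ : ∀ a ∈ P₀, -a ∈ P₀ → a = 0) :
    ∃ P : AddSubmonoid G, P₀ ≤ P ∧ (∀ a ∈ P, -a ∈ P → a = 0) ∧ ∀ a, a ∈ P ∨ -a ∈ P := by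
  obtain ⟨P, hP₀, hmax⟩ := zorn_le_nonempty₀ {P : AddSubmonoid G | ∀ a ∈ P, -a ∈ P → a = 0}
    (by
      intro c hc hchain Q hQ
      refine ⟨sSup c, fun a ha hna => ?_, fun z hz => le_sSup hz⟩
      rw [AddSubmonoid.mem_sSup_of_directedOn ⟨Q, hQ⟩ hchain.directedOn] at ha hna
      obtain ⟨R, hR, haR⟩ := ha
      obtain ⟨S, hS, haS⟩ := hna
      rcases hchain.total hR hS with h | h
      · exact hc hS a (h haR) haS
      · exact hc hR a haR (h haS)) P₀ h₀
  have hP : ∀ a ∈ P, -a ∈ P → a = 0 := hmax.prop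
  -- If adjoining `a` spoils pointedness, then a positive multiple of `-a` lies in `P`.
  have key : ∀ a, a ∉ P → ∃ k : ℕ, k ≠ 0 ∧ -(k • a) ∈ P := by
    intro a ha
    have hlt : ¬ P ⊔ AddSubmonoid.multiples a ≤ P := fun h =>
      ha (h (AddSubmonoid.mem_sup_right (AddSubmonoid.mem_multiples a)))
    have hnot : ¬ ∀ b ∈ P ⊔ AddSubmonoid.multiples a, -b ∈ P ⊔ AddSubmonoid.multiples a → b = 0 :=
      fun h => hlt (hmax.le_of_ge h le_sup_left)
    push Not at hnot
    obtain ⟨b, hb, hnb, hb0⟩ := hnot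
    obtain ⟨p, hp, _, ⟨k, rfl⟩, hpk⟩ := AddSubmonoid.mem_sup.mp hb
    obtain ⟨q, hq, _, ⟨l, rfl⟩, hql⟩ := AddSubmonoid.mem_sup.mp hnb
    have hsum : (p + q) + (k + l) • a = 0 := by
      have : (p + k • a) + (q + l • a) = 0 := by
        simp only at hpk hql
        rw [hpk, hql, add_neg_cancel]
      rw [← this, add_nsmul]
      abel
    refine ⟨k + l, fun hkl => hb0 ?_, ?_⟩
    · obtain ⟨rfl, rfl⟩ : k = 0 ∧ l = 0 := by omega
      have hpb : p = b := by simpa using hpk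
      have hqb : q = -b := by simpa using hql
      exact hP b (hpb ▸ hp) (hqb ▸ hq)
    · rw [← eq_neg_of_add_eq_zero_left hsum]
      exact add_mem hp hq
  refine ⟨P, hP₀, hP, fun a => ?_⟩
  by_contra! hcon
  obtain ⟨k, hk, hkP⟩ := key a hcon.1
  obtain ⟨l, hl, hlP⟩ := key (-a) hcon.2
  have h1 : (k * l) • a ∈ P := by
    have := nsmul_mem hlP k
    rwa [smul_neg, smul_neg, smul_neg, neg_neg, ← mul_smul] at this
  have h2 : -((k * l) • a) ∈ P := by
    have := nsmul_mem hkP l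
    rwa [smul_neg, ← mul_smul, mul_comm] at this
  have h3 := hP _ h1 h2
  rw [smul_eq_zero_iff_right (mul_ne_zero hk hl)] at h3
  exact hcon.1 (h3 ▸ zero_mem P)

section MonomialOrder

variable {n : ℕ}

/-- The cone of nonnegative elements of a total group order on `ℤⁿ` that extends the componentwise
order. -/
structure TotalCone (n : ℕ) extends AddSubmonoid (Fin n → ℤ) where
  eq_zero_of_mem_of_neg_mem : ∀ v ∈ toAddSubmonoid, -v ∈ toAddSubmonoid → v = 0
  mem_or_neg_mem : ∀ v, v ∈ toAddSubmonoid ∨ -v ∈ toAddSubmonoid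
  mem_of_nonneg : ∀ v, 0 ≤ v → v ∈ toAddSubmonoid

namespace TotalCone

variable (P : TotalCone n)

/-- The exponent vectors, with the order for which `a ≤ b` if and only if `b - a` lies in the cone
`P`. -/
@[ext]
structure Exponent (_P : TotalCone n) where
  /-- The underlying exponent vector. -/
  exp : Fin n →₀ ℕ

variable {P}

/-- The bijection that forgets the order attached to an exponent vector. -/
def Exponent.equiv : P.Exponent ≃ (Fin n →₀ ℕ) where
  toFun := Exponent.exp
  invFun := Exponent.mk
  left_inv _ := rfl
  right_inv _ := rfl

noncomputable instance : AddCommMonoid P.Exponent := Exponent.equiv.addCommMonoid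

@[simp]
lemma Exponent.exp_add (a b : P.Exponent) : (a + b).exp = a.exp + b.exp := rfl

noncomputable instance : LinearOrder P.Exponent where
  le a b := diffVec b.exp a.exp ∈ P.toAddSubmonoid
  le_refl a := by
    rw [diffVec_self]
    exact zero_mem _
  le_trans a b c hab hbc := by
    convert add_mem hbc hab using 1
    ext j
    simp
  le_antisymm a b hab hba := by
    refine Exponent.ext (eq_of_diffVec_eq_zero (P.eq_zero_of_mem_of_neg_mem _ hba ?_))
    convert hab using 1
    ext j
    simp
  le_total a b := by
    rcases P.mem_or_neg_mem (diffVec b.exp a.exp) with h | h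
    · exact .inl h
    · right
      convert h using 1
      ext j
      simp
  toDecidableLE := Classical.decRel _

lemma Exponent.le_iff {a b : P.Exponent} : a ≤ b ↔ diffVec b.exp a.exp ∈ P.toAddSubmonoid :=
  Iff.rfl

lemma Exponent.le_of_exp_le {a b : P.Exponent} (hab : a.exp ≤ b.exp) : a ≤ b := by
  refine P.mem_of_nonneg _ fun j => ?_
  have := hab j
  simp only [diffVec_apply, Pi.zero_apply]
  omega

instance : IsOrderedAddMonoid P.Exponent where
  add_le_add_left a b h c := by
    rw [Exponent.le_iff] at h ⊢
    convert h using 1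
    ext j
    simp

-- Dickson's lemma: the componentwise order is a well-quasi-order, and hence so is any extension.
instance : WellFoundedLT P.Exponent := by
  have : WellQuasiOrderedLE P.Exponent := by
    refine ⟨fun f => ?_⟩
    obtain ⟨i, j, hij, h⟩ := wellQuasiOrdered_le fun k => (f k).exp
    exact ⟨i, j, hij, Exponent.le_of_exp_le h⟩
  infer_instance

variable (P)

/-- The monomial order with `x^a ≤ x^b` if and only if `b - a` lies in the cone `P`. -/
noncomputable def monomialOrder : MonomialOrder.{0, 0} (Fin n) where
  syn := P.Exponent
  toSyn := Exponent.equiv.addEquiv.symm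
  toSyn_monotone _ _ h := Exponent.le_of_exp_le h

lemma isPos_monomialOrder {v : Fin n → ℤ} (hv : v ∈ P.toAddSubmonoid) (h0 : v ≠ 0) :
    IsPos P.monomialOrder v := by
  refine lt_of_le_of_ne (Exponent.le_iff.mpr ?_) fun h => h0 (eq_zero_of_posExp_eq_negExp ?_)
  · change diffVec (posExp v) (negExp v) ∈ P.toAddSubmonoid
    rwa [diffVec_posExp_negExp]
  · exact (P.monomialOrder.toSyn.injective h).symm

end TotalCone

/-- If a lattice contains no nonzero nonnegative vector, then for every pointed cone in the lattice
there is a monomial order for which the nonzero vectors of the cone are positive. -/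
lemma exists_monomialOrder_isPos {m : ℕ} {A : Matrix (Fin m) (Fin n) ℤ} (hA : IsPositivelyGraded A)
    (S : AddSubmonoid (Fin n → ℤ)) (hSA : ∀ v ∈ S, v ∈ kerZ A) (hS : ∀ v ∈ S, -v ∈ S → v = 0) :
    ∃ ord : MonomialOrder.{0, 0} (Fin n), ∀ v ∈ S, v ≠ 0 → IsPos ord v := by
  obtain ⟨P, hle, hP, htot⟩ := exists_total_cone (AddSubmonoid.nonneg (Fin n → ℤ) ⊔ S) (by
    intro v hv hnv
    obtain ⟨a, ha, s, hs, has⟩ := AddSubmonoid.mem_sup.mp hv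
    obtain ⟨b, hb, t, ht, hbt⟩ := AddSubmonoid.mem_sup.mp hnv
    rw [AddSubmonoid.mem_nonneg] at ha hb
    -- The nonnegative vector `a + b = -(s + t)` lies in the lattice.
    have hsum : (a + b) + (s + t) = 0 := by
      rw [add_add_add_comm, has, hbt, add_neg_cancel]
    have hab : a + b = 0 := by
      refine hA _ ?_ (add_nonneg ha hb)
      rw [eq_neg_of_add_eq_zero_left hsum]
      exact neg_mem (add_mem (hSA s hs) (hSA t ht))
    rw [hab, zero_add] at hsum
    have ha0 : a = 0 := by
      refine le_antisymm ?_ ha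
      rw [eq_neg_of_add_eq_zero_left hab]
      exact neg_nonpos.mpr hb
    have hs0 : s = 0 := hS s hs (by rwa [neg_eq_of_add_eq_zero_right hsum])
    rw [← has, ha0, hs0, add_zero])
  let C : TotalCone n := ⟨P, hP, htot, fun v hv => hle (AddSubmonoid.mem_sup_left hv)⟩
  exact ⟨C.monomialOrder,
    fun v hv h0 => C.isPos_monomialOrder (hle (AddSubmonoid.mem_sup_right hv)) h0⟩

end MonomialOrder

/-! ### Gale transforms and bouquets -/

section Gale

variable {m n : ℕ} {A : Matrix (Fin m) (Fin n) ℤ}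

lemma exists_eq_sum_gale {v : Fin n → ℤ} (hv : v ∈ kerZ A) :
    ∃ z : Fin (Module.finrank ℤ (kerZ A)) → ℤ, ∀ j, v j = ∑ l, z l * gale A j l := by
  refine ⟨fun l => (Module.finBasis ℤ (kerZ A)).repr ⟨v, hv⟩ l, fun j => ?_⟩
  have h := congrArg (fun w : kerZ A => (w : Fin n → ℤ) j)
    ((Module.finBasis ℤ (kerZ A)).sum_repr ⟨v, hv⟩)
  simp only [Submodule.coe_sum, Submodule.coe_smul, Finset.sum_apply, Pi.smul_apply,
    smul_eq_mul] at h
  exact h.symm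

lemma IsFree.apply_eq_zero {j : Fin n} (hj : IsFree A j) {v : Fin n → ℤ} (hv : v ∈ kerZ A) :
    v j = 0 := by
  obtain ⟨z, hz⟩ := exists_eq_sum_gale hv
  rw [hz, show gale A j = 0 from hj]
  simp

/-- The rows of the Gale transform in one bouquet are rational multiples of each other; hence the
bouquets are cliques. -/
lemma exists_galeRatio_of_reachable {j k : Fin n} (h : (bouquetGraph A).Reachable j k) :
    ∃ c, GaleRatio A j k c := by
  obtain ⟨p⟩ := h
  induction p with
  | nil => exact ⟨1, fun l => (one_mul _).symm⟩
  | cons hadj _ ih =>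
    obtain ⟨c, hc⟩ := ih
    obtain ⟨d, hd⟩ := hadj.2.1
    exact ⟨d * c, fun l => by rw [hd, hc, mul_assoc]⟩

lemma gale_mul_gale_comm {j k : Fin n} (h : (bouquetGraph A).Reachable j k) (l l') :
    gale A j l * gale A k l' = gale A k l * gale A j l' := by
  obtain ⟨c, hc⟩ := exists_galeRatio_of_reachable h
  have : (gale A j l : ℚ) * gale A k l' = gale A k l * gale A j l' := by
    rw [hc l, hc l']
    ring
  exact_mod_cast this

lemma mul_gale_comm {j k : Fin n} (h : (bouquetGraph A).Reachable j k) (l) {v : Fin n → ℤ}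
    (hv : v ∈ kerZ A) : v j * gale A k l = v k * gale A j l := by
  obtain ⟨z, hz⟩ := exists_eq_sum_gale hv
  rw [hz, hz, Finset.sum_mul, Finset.sum_mul]
  refine Finset.sum_congr rfl fun l' _ => ?_
  rw [mul_assoc, mul_assoc, gale_mul_gale_comm h]

end Gale

namespace BouquetData

variable {m n s : ℕ} {A : Matrix (Fin m) (Fin n) ℤ} (B : BouquetData A s)

/-- The number of the bouquet that contains `j`. -/
def index (j : Fin n) : Fin s := B.label ((bouquetGraph A).connectedComponentMk j)

lemma mem_bouquet_iff {i : Fin s} {j : Fin n} : j ∈ B.bouquet i ↔ B.index j = i := by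
  simp [bouquet, index]

lemma first_mem_bouquet (i : Fin s) : B.first i ∈ B.bouquet i :=
  B.mem_bouquet_iff.mpr (B.first_mem i)

variable {B}

lemma reachable_of_mem {i : Fin s} {j k : Fin n} (hj : j ∈ B.bouquet i) (hk : k ∈ B.bouquet i) :
    (bouquetGraph A).Reachable j k := by
  rw [mem_bouquet_iff] at hj hk
  exact SimpleGraph.ConnectedComponent.exact (B.label.injective (hj.trans hk.symm))

lemma isFree_of_isFree {i : Fin s} {j k : Fin n} (hj : j ∈ B.bouquet i) (hk : k ∈ B.bouquet i)
    (h : IsFree A k) : IsFree A j := by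
  obtain ⟨c, hc⟩ := exists_galeRatio_of_reachable (reachable_of_mem hj hk)
  ext l
  have := hc l
  rw [show gale A k = 0 from h] at this
  simpa using this

lemma exists_forall_gale_ne_zero {i : Fin s} (h : ¬ IsFree A (B.first i)) :
    ∃ l, ∀ k ∈ B.bouquet i, gale A k l ≠ 0 := by
  obtain ⟨l, hl⟩ := Function.ne_iff.mp h
  refine ⟨l, fun k hk h0 => hl ?_⟩
  obtain ⟨c, hc⟩ := exists_galeRatio_of_reachable (reachable_of_mem (B.first_mem_bouquet i) hk)
  have := hc l
  rw [h0] at this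
  simpa using this

/-- On a bouquet that is not free, `g • c_{B_i}` is the `l`-th column of the Gale transform up to
sign, where `g > 0` is the gcd of the entries of that column. -/
lemma exists_cVec_mul_gcd {i : Fin s} (h : ¬ IsFree A (B.first i)) :
    ∃ l, (∀ k ∈ B.bouquet i, gale A k l ≠ 0) ∧ 0 < ((B.bouquet i).gcd fun k => gale A k l) ∧
      ∀ j ∈ B.bouquet i, B.cVec i j * ((B.bouquet i).gcd fun k => gale A k l) =
        (gale A (B.first i) l).sign * gale A j l := by
  have hex := exists_forall_gale_ne_zero h
  refine ⟨hex.choose, hex.choose_spec, lt_of_le_of_ne ?_ fun h0 => ?_, fun j hj => ?_⟩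
  · rw [← Finset.normalize_gcd]
    exact Int.nonneg_of_normalize_eq_self (normalize_idem _)
  · exact hex.choose_spec _ (B.first_mem_bouquet i)
      (Finset.gcd_eq_zero_iff.mp h0.symm _ (B.first_mem_bouquet i))
  · rw [cVec, if_pos hj, dif_pos hex, mul_assoc,
      Int.ediv_mul_cancel (Finset.gcd_dvd (f := fun k => gale A k hex.choose) hj)]

lemma cVec_eq_zero {i : Fin s} {j : Fin n} (hj : j ∉ B.bouquet i) : B.cVec i j = 0 := by
  rw [cVec, if_neg hj]

lemma cVec_of_isFree {i : Fin s} {j : Fin n} (hj : j ∈ B.bouquet i) (h : IsFree A (B.first i)) :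
    B.cVec i j = B.freeVec j := by
  rw [cVec, if_pos hj, dif_neg]
  rintro ⟨l, hl⟩
  exact hl _ (B.first_mem_bouquet i) (congrFun h l)

lemma cVec_ne_zero {i : Fin s} {j : Fin n} (hj : j ∈ B.bouquet i) : B.cVec i j ≠ 0 := by
  by_cases h : IsFree A (B.first i)
  · rw [cVec_of_isFree hj h]
    exact B.freeVec_ne_zero j (isFree_of_isFree hj (B.first_mem_bouquet i) h)
  · obtain ⟨l, hne, -, hl⟩ := exists_cVec_mul_gcd h
    intro h0
    have := hl j hj
    rw [h0, zero_mul, eq_comm, mul_eq_zero, Int.sign_eq_zero_iff_zero] at this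
    exact this.elim (hne _ (B.first_mem_bouquet i)) (hne j hj)

variable (B) in
lemma cVec_first_pos (i : Fin s) : 0 < B.cVec i (B.first i) := by
  by_cases h : IsFree A (B.first i)
  · rw [cVec_of_isFree (B.first_mem_bouquet i) h]
    exact B.freeVec_first_pos i h
  · obtain ⟨l, hne, hg, hl⟩ := exists_cVec_mul_gcd h
    have := hl _ (B.first_mem_bouquet i)
    rw [Int.sign_mul_self_eq_abs] at this
    exact pos_of_mul_pos_left (this ▸ abs_pos.mpr (hne _ (B.first_mem_bouquet i))) hg.le

/-- On a bouquet that is not free, products of two coordinates of `c_{B_i}` have the same sign as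
the products of the corresponding entries of a column of the Gale transform. -/
lemma exists_cVec_mul_cVec {i : Fin s} (h : ¬ IsFree A (B.first i)) :
    ∃ l, ∃ g : ℤ, 0 < g ∧ (∀ k ∈ B.bouquet i, gale A k l ≠ 0) ∧ ∀ j ∈ B.bouquet i,
      ∀ k ∈ B.bouquet i, B.cVec i j * B.cVec i k * g = gale A j l * gale A k l := by
  obtain ⟨l, hne, hg, hl⟩ := exists_cVec_mul_gcd h
  refine ⟨l, _, mul_pos hg hg, hne, fun j hj k hk => ?_⟩
  rw [mul_mul_mul_comm, hl j hj, hl k hk, mul_mul_mul_comm, ← Int.sign_mul,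
    Int.sign_eq_one_of_pos (mul_self_pos.mpr (hne _ (B.first_mem_bouquet i))), one_mul]

lemma cVec_pos_of_isNonMixed {i : Fin s} (h : B.IsNonMixed i) {j : Fin n}
    (hj : j ∈ B.bouquet i) : 0 < B.cVec i j := by
  by_cases hjf : j = B.first i
  · rw [hjf]
    exact B.cVec_first_pos i
  obtain ⟨l, g, hg, hne, hl⟩ := exists_cVec_mul_cVec (h.1 _ (B.first_mem_bouquet i))
  have hreach := reachable_of_mem hj (B.first_mem_bouquet i)
  obtain ⟨c, hc⟩ := exists_galeRatio_of_reachable hreach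
  have hc0 : 0 < c := h.2 j hj _ (B.first_mem_bouquet i)
    ⟨hjf, ⟨c, hc⟩, exists_galeRatio_of_reachable hreach.symm⟩ c hc
  have hpos : (0 : ℚ) < gale A j l * gale A (B.first i) l := by
    rw [hc l, mul_assoc]
    refine mul_pos hc0 (mul_self_pos.mpr ?_)
    exact_mod_cast hne _ (B.first_mem_bouquet i)
  have hpos' : 0 < gale A j l * gale A (B.first i) l := by exact_mod_cast hpos
  rw [← hl j hj _ (B.first_mem_bouquet i)] at hpos'
  exact pos_of_mul_pos_left (pos_of_mul_pos_left hpos' hg.le) (B.cVec_first_pos i).le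

lemma exists_cVec_neg_of_not_isNonMixed {i : Fin s} (h : ¬ B.IsNonMixed i)
    (hfree : ¬ IsFree A (B.first i)) : ∃ j ∈ B.bouquet i, B.cVec i j < 0 := by
  have h1 : ∀ j ∈ B.bouquet i, ¬ IsFree A j := fun j hj hj' =>
    hfree (isFree_of_isFree (B.first_mem_bouquet i) hj hj')
  rw [IsNonMixed, not_and] at h
  have h2 := h h1
  push Not at h2
  obtain ⟨j, hj, k, hk, -, c, hc, hc0⟩ := h2
  obtain ⟨l, g, hg, hne, hl⟩ := exists_cVec_mul_cVec hfree
  have hle : (gale A j l * gale A k l : ℚ) ≤ 0 := by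
    rw [hc l, mul_assoc]
    exact mul_nonpos_of_nonpos_of_nonneg hc0 (mul_self_nonneg _)
  have hle' : gale A j l * gale A k l ≤ 0 := by exact_mod_cast hle
  rw [← hl j hj k hk] at hle'
  by_contra! hcon
  have hjpos := lt_of_le_of_ne (hcon j hj) (cVec_ne_zero hj).symm
  have hkpos := lt_of_le_of_ne (hcon k hk) (cVec_ne_zero hk).symm
  exact absurd (mul_pos (mul_pos hjpos hkpos) hg) hle'.not_gt

/-! ### The isomorphism between the lattices of a matrix and of its bouquet matrix -/

lemma D_apply (u : Fin s → ℤ) (j : Fin n) : B.D u j = u (B.index j) * B.cVec (B.index j) j := by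
  rw [D, Finset.sum_apply, Finset.sum_eq_single (B.index j)]
  · rfl
  · intro i _ hi
    rw [Pi.smul_apply, cVec_eq_zero fun h => hi (B.mem_bouquet_iff.mp h).symm, smul_zero]
  · simp

lemma D_apply_of_mem (u : Fin s → ℤ) {i : Fin s} {j : Fin n} (hj : j ∈ B.bouquet i) :
    B.D u j = u i * B.cVec i j := by
  rw [D_apply, B.mem_bouquet_iff.mp hj]

lemma D_add (u w : Fin s → ℤ) : B.D (u + w) = B.D u + B.D w := by
  ext j
  simp only [D_apply, Pi.add_apply, add_mul]

lemma D_neg (u : Fin s → ℤ) : B.D (-u) = -B.D u := by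
  ext j
  simp only [D_apply, Pi.neg_apply, neg_mul]

variable (B) in
lemma D_injective : Function.Injective B.D := by
  intro u w h
  ext i
  have := congrFun h (B.first i)
  rw [D_apply_of_mem u (B.first_mem_bouquet i), D_apply_of_mem w (B.first_mem_bouquet i)] at this
  exact mul_right_cancel₀ (B.cVec_first_pos i).ne' this

lemma D_eq_zero_iff {u : Fin s → ℤ} : B.D u = 0 ↔ u = 0 := by
  have h0 : B.D 0 = 0 := by
    ext j
    simp [D_apply]
  rw [← h0, B.D_injective.eq_iff]

lemma D_mem_kerZ_iff {u : Fin s → ℤ} : B.D u ∈ kerZ A ↔ u ∈ kerZ B.bouquetMatrix := by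
  have h : A.mulVec (B.D u) = B.bouquetMatrix.mulVec u := by
    ext r
    simp only [Matrix.mulVec, dotProduct, bouquetMatrix, Matrix.of_apply, D, Finset.sum_apply,
      Pi.smul_apply, smul_eq_mul, Finset.mul_sum, Finset.sum_mul]
    rw [Finset.sum_comm]
    refine Finset.sum_congr rfl fun i _ => Finset.sum_congr rfl fun j _ => ?_
    ring
  rw [kerZ, kerZ, LinearMap.mem_ker, LinearMap.mem_ker, Matrix.mulVecLin_apply,
    Matrix.mulVecLin_apply, h]

/-- On each bouquet a lattice vector is proportional to `c_{B_i}`, and the factor is an integer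
since `c_{B_i}` is primitive. -/
lemma exists_eq_mul_cVec {v : Fin n → ℤ} (hv : v ∈ kerZ A) (i : Fin s) :
    ∃ t : ℤ, ∀ j ∈ B.bouquet i, v j = t * B.cVec i j := by
  by_cases h : IsFree A (B.first i)
  · refine ⟨0, fun j hj => ?_⟩
    rw [zero_mul, (isFree_of_isFree hj (B.first_mem_bouquet i) h).apply_eq_zero hv]
  · obtain ⟨l, hne, hg, hl⟩ := exists_cVec_mul_gcd h
    obtain ⟨x, hx⟩ := Finset.gcd_eq_sum_mul (B.bouquet i) fun k => gale A k l
    set ε := (gale A (B.first i) l).sign with hε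
    have hεε : ε * ε = 1 := by
      rw [hε, ← Int.sign_mul]
      exact Int.sign_eq_one_of_pos (mul_self_pos.mpr (hne _ (B.first_mem_bouquet i)))
    refine ⟨ε * ∑ k ∈ B.bouquet i, v k * x k, fun j hj => mul_right_cancel₀ hg.ne' ?_⟩
    rw [mul_assoc, hl j hj, mul_mul_mul_comm, hεε, one_mul, hx, Finset.mul_sum, Finset.sum_mul]
    refine Finset.sum_congr rfl fun k hk => ?_
    linear_combination x k * mul_gale_comm (reachable_of_mem hj hk) l hv

lemma exists_D_eq {v : Fin n → ℤ} (hv : v ∈ kerZ A) :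
    ∃ u ∈ kerZ B.bouquetMatrix, B.D u = v := by
  choose t ht using exists_eq_mul_cVec (B := B) hv
  have h : B.D t = v := by
    ext j
    rw [D_apply, ht _ j (B.mem_bouquet_iff.mpr rfl)]
  exact ⟨t, D_mem_kerZ_iff.mp (by rwa [h]), h⟩

/-! ### Divisibility of monomials in terms of the bouquets -/

lemma toNat_mul_le_toNat_mul_iff {c x y : ℤ} (hc : 0 < c) :
    (x * c).toNat ≤ (y * c).toNat ↔ x.toNat ≤ y.toNat := by
  rw [Int.toNat_le, Int.toNat_le, Int.ofNat_toNat, Int.ofNat_toNat]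
  rcases le_or_gt x 0 with hx | hx
  · exact iff_of_true ((mul_nonpos_of_nonpos_of_nonneg hx hc.le).trans (le_max_right _ _))
      (hx.trans (le_max_right _ _))
  · rw [le_max_iff, le_max_iff, mul_le_mul_iff_left₀ hc]
    exact or_congr_right (iff_of_false (mul_pos hx hc).not_ge hx.not_ge)

lemma toNat_mul_le_toNat_mul_iff_of_neg {c x y : ℤ} (hc : c < 0) :
    (x * c).toNat ≤ (y * c).toNat ↔ (-x).toNat ≤ (-y).toNat := by
  rw [← neg_mul_neg, ← neg_mul_neg y, toNat_mul_le_toNat_mul_iff (neg_pos.mpr hc)]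

/-- Whether `x^{D(u)⁺}` divides `x^{D(w)⁺}` depends only on `u`, `w` and the set of non-mixed
bouquets: a non-mixed bouquet compares the positive parts of the coordinates of `u` and `w`, and a
mixed bouquet, in which `c_{B_i}` has entries of both signs, compares the negative parts too. On a
free bouquet the coordinates vanish. -/
lemma posExp_D_le_iff {u w : Fin s → ℤ} (hu : u ∈ kerZ B.bouquetMatrix) :
    posExp (B.D u) ≤ posExp (B.D w) ↔ ∀ i, (u i).toNat ≤ (w i).toNat ∧
      (¬ B.IsNonMixed i → (-u i).toNat ≤ (-w i).toNat) := by
  constructor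
  · intro h i
    constructor
    · have := h (B.first i)
      rwa [posExp_apply, posExp_apply, D_apply_of_mem _ (B.first_mem_bouquet i),
        D_apply_of_mem _ (B.first_mem_bouquet i),
        toNat_mul_le_toNat_mul_iff (B.cVec_first_pos i)] at this
    · intro hi
      by_cases hfree : IsFree A (B.first i)
      · have := hfree.apply_eq_zero (D_mem_kerZ_iff.mpr hu)
        rw [D_apply_of_mem _ (B.first_mem_bouquet i), mul_eq_zero,
          or_iff_left (B.cVec_first_pos i).ne'] at this
        simp [this]
      · obtain ⟨j, hj, hneg⟩ := exists_cVec_neg_of_not_isNonMixed hi hfree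
        have := h j
        rwa [posExp_apply, posExp_apply, D_apply_of_mem _ hj, D_apply_of_mem _ hj,
          toNat_mul_le_toNat_mul_iff_of_neg hneg] at this
  · intro h j
    have hj : j ∈ B.bouquet (B.index j) := B.mem_bouquet_iff.mpr rfl
    rw [posExp_apply, posExp_apply, D_apply_of_mem _ hj, D_apply_of_mem _ hj]
    rcases lt_or_gt_of_ne (cVec_ne_zero hj) with hneg | hpos
    · rw [toNat_mul_le_toNat_mul_iff_of_neg hneg]
      exact (h _).2 fun hi => (cVec_pos_of_isNonMixed hi hj).not_gt hneg
    · rw [toNat_mul_le_toNat_mul_iff hpos]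
      exact (h _).1

end BouquetData

/-! ### Transfer between robust toric ideals -/

section Lattice

variable {K : Type*} [Field K] {m n p s : ℕ} {A : Matrix (Fin m) (Fin n) ℤ}
  {T : Matrix (Fin p) (Fin s) ℤ} {ω : Set (Fin s)} {B : BouquetData A s}
  {ord : MonomialOrder (Fin n)}

lemma BouquetData.IsRobust.kerZ_eq (h : B.IsRobust K T ω) : kerZ B.bouquetMatrix = kerZ T :=
  kerZ_eq_of_toricIdeal_eq h.1

lemma BouquetData.IsRobust.D_mem_iff (h : B.IsRobust K T ω) {u : Fin s → ℤ} :
    B.D u ∈ kerZ A ↔ u ∈ kerZ T := by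
  rw [B.D_mem_kerZ_iff, h.kerZ_eq]

/-- `D` maps `Ker_ℤ(T)` onto `Ker_ℤ(A)`, so that a lattice vector may be assumed to be of the form
`D u`. -/
lemma BouquetData.IsRobust.forall_mem_kerZ_iff (h : B.IsRobust K T ω) {P : (Fin n → ℤ) → Prop} :
    (∀ v ∈ kerZ A, P v) ↔ ∀ u ∈ kerZ T, P (B.D u) := by
  refine ⟨fun hP u hu => hP _ (h.D_mem_iff.mpr hu), fun hP v hv => ?_⟩
  obtain ⟨u, hu, rfl⟩ := B.exists_D_eq hv
  exact hP u (h.kerZ_eq ▸ hu)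

lemma BouquetData.IsRobust.exists_mem_kerZ_iff (h : B.IsRobust K T ω) {P : (Fin n → ℤ) → Prop} :
    (∃ v ∈ kerZ A, P v) ↔ ∃ u ∈ kerZ T, P (B.D u) := by
  have := h.forall_mem_kerZ_iff (P := fun v => ¬ P v)
  rw [← not_iff_not]
  push Not
  exact this

lemma BouquetData.IsRobust.posExp_D_le_iff (h : B.IsRobust K T ω) {u w : Fin s → ℤ}
    (hu : u ∈ kerZ T) :
    posExp (B.D u) ≤ posExp (B.D w) ↔
      ∀ i, (u i).toNat ≤ (w i).toNat ∧ (i ∉ ω → (-u i).toNat ≤ (-w i).toNat) := by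
  rw [B.posExp_D_le_iff (h.kerZ_eq ▸ hu), h.2]
  rfl

lemma BouquetData.IsRobust.D_mem_reducedVectors_iff (h : B.IsRobust K T ω) {u : Fin s → ℤ} :
    B.D u ∈ reducedVectors ord A ↔ u ∈ kerZ T ∧ IsPos ord (B.D u) ∧
      (∀ w ∈ kerZ T, IsPos ord (B.D w) →
        posExp (B.D w) ≤ posExp (B.D u) → posExp (B.D u) ≤ posExp (B.D w)) ∧
      ∀ w ∈ kerZ T, IsPos ord (B.D w) → ¬ posExp (B.D w) ≤ posExp (B.D (-u)) := by
  rw [reducedVectors, Set.mem_ofPred_eq, h.D_mem_iff, h.forall_mem_kerZ_iff, h.forall_mem_kerZ_iff,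
    B.D_neg, posExp_neg]

lemma BouquetData.binom_image_reducedVectors (B : BouquetData A s) :
    binom K '' reducedVectors ord A =
      (fun u => binom K (B.D u)) '' {u | B.D u ∈ reducedVectors ord A} := by
  ext g
  constructor
  · rintro ⟨v, hv, rfl⟩
    obtain ⟨u, -, rfl⟩ := B.exists_D_eq hv.1
    exact ⟨u, hv, rfl⟩
  · rintro ⟨u, hu, rfl⟩
    exact ⟨_, hu, rfl⟩

lemma BouquetData.binom_D_eq_iff {u w : Fin s → ℤ} :
    binom K (B.D u) = binom K (B.D w) ↔ u = w ∨ u = -w ∧ (2 : K) = 0 := by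
  rw [binom_eq_binom_iff, ← B.D_neg, B.D_injective.eq_iff, B.D_injective.eq_iff]

lemma monomial_mem_posMonomialIdeal_iff {D : (Fin s → ℤ) → Fin n → ℤ} {U : Set (Fin s → ℤ)}
    {a : Fin n →₀ ℕ} :
    monomial a (1 : K) ∈ posMonomialIdeal K D U ↔ ∃ u ∈ U, posExp (D u) ≤ a := by
  classical
  have himg : (fun u => monomial (posExp (D u)) (1 : K)) '' U =
      (fun a => monomial a (1 : K)) '' ((fun u => posExp (D u)) '' U) := by
    rw [Set.image_image]
  rw [posMonomialIdeal, himg, mem_ideal_span_monomial_image, support_monomial,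
    if_neg one_ne_zero]
  simp

/-- The monomials `x^{D(u)⁺}`, `u ∈ U`, generate the initial ideal if and only if the sets of the
`D(u)⁺` with `u ∈ U` and with `D(u)` positive are cofinal in each other for divisibility. -/
lemma BouquetData.IsRobust.initialIdeal_eq_posMonomialIdeal_iff (h : B.IsRobust K T ω)
    {U : Set (Fin s → ℤ)} :
    initialIdeal ord (toricIdeal K A) = posMonomialIdeal K B.D U ↔
      (∀ u ∈ kerZ T, IsPos ord (B.D u) → ∃ w ∈ U, posExp (B.D w) ≤ posExp (B.D u)) ∧
      ∀ w ∈ U, ∃ u ∈ kerZ T, IsPos ord (B.D u) ∧ posExp (B.D u) ≤ posExp (B.D w) := by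
  constructor
  · intro heq
    refine ⟨fun u hu hpos => ?_, fun w hw => ?_⟩
    · rw [← monomial_mem_posMonomialIdeal_iff (K := K), ← heq, monomial_mem_initialIdeal_iff]
      exact ⟨_, h.D_mem_iff.mpr hu, hpos, le_rfl⟩
    · have hmem : monomial (posExp (B.D w)) (1 : K) ∈ initialIdeal ord (toricIdeal K A) := by
        rw [heq, monomial_mem_posMonomialIdeal_iff]
        exact ⟨w, hw, le_rfl⟩
      rwa [monomial_mem_initialIdeal_iff, h.exists_mem_kerZ_iff] at hmem
  · rintro ⟨h1, h2⟩
    refine le_antisymm ?_ (Ideal.span_le.mpr ?_)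
    · rw [initialIdeal_toricIdeal]
      refine Ideal.span_le.mpr ?_
      rintro _ ⟨_, ⟨v, ⟨hv, hpos⟩, rfl⟩, rfl⟩
      obtain ⟨u, hu, rfl⟩ := B.exists_D_eq hv
      exact monomial_mem_posMonomialIdeal_iff.mpr (h1 u (h.kerZ_eq ▸ hu) hpos)
    · rintro _ ⟨w, hw, rfl⟩
      exact monomial_mem_initialIdeal_iff.mpr (h.exists_mem_kerZ_iff.mpr (h2 w hw))

end Lattice

section Transfer

variable {K : Type*} [Field K] {m₁ m₂ n₁ n₂ p s : ℕ} {A₁ : Matrix (Fin m₁) (Fin n₁) ℤ}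
  {A₂ : Matrix (Fin m₂) (Fin n₂) ℤ} {T : Matrix (Fin p) (Fin s) ℤ} {ω : Set (Fin s)}
  {B₁ : BouquetData A₁ s} {B₂ : BouquetData A₂ s}
  {ord₁ : MonomialOrder (Fin n₁)} {ord₂ : MonomialOrder (Fin n₂)}

/-- Two monomial orders are compatible if they single out the same vectors of `Ker_ℤ(T)` as
positive, through the maps `D` of the two matrices. -/
def OrdersCompatible (T : Matrix (Fin p) (Fin s) ℤ) (B₁ : BouquetData A₁ s)
    (B₂ : BouquetData A₂ s) (ord₁ : MonomialOrder (Fin n₁)) (ord₂ : MonomialOrder (Fin n₂)) :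
    Prop :=
  ∀ u ∈ kerZ T, (IsPos ord₁ (B₁.D u) ↔ IsPos ord₂ (B₂.D u))

/-- The vectors `D₂(u)` with `u = 0` or `D₁(u)` positive form a pointed cone in the lattice of `A₂`,
which extends to a monomial order. Compatibility holds in both directions since of `u` and `-u`
exactly one is positive, unless `u = 0`. -/
lemma exists_ordersCompatible (hA₂ : IsPositivelyGraded A₂) (h₂ : B₂.IsRobust K T ω)
    (ord₁ : MonomialOrder (Fin n₁)) :
    ∃ ord₂ : MonomialOrder.{0, 0} (Fin n₂), OrdersCompatible T B₁ B₂ ord₁ ord₂ := by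
  let S : AddSubmonoid (Fin n₂ → ℤ) :=
    { carrier := {v | ∃ u ∈ kerZ T, (u = 0 ∨ IsPos ord₁ (B₁.D u)) ∧ B₂.D u = v}
      zero_mem' := ⟨0, zero_mem _, .inl rfl, B₂.D_eq_zero_iff.mpr rfl⟩
      add_mem' := by
        rintro _ _ ⟨u, hu, hu', rfl⟩ ⟨w, hw, hw', rfl⟩
        refine ⟨u + w, add_mem hu hw, ?_, B₂.D_add u w⟩
        rcases hu' with rfl | hu'
        · rwa [zero_add]
        · rcases hw' with rfl | hw'
          · rw [add_zero]
            exact .inr hu'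
          · rw [B₁.D_add]
            exact .inr (hu'.add hw') }
  obtain ⟨ord₂, hord⟩ := exists_monomialOrder_isPos hA₂ S
    (by
      rintro _ ⟨u, hu, -, rfl⟩
      exact h₂.D_mem_iff.mpr hu)
    (by
      rintro _ ⟨u, hu, hu', rfl⟩ ⟨w, hw, hw', hwu⟩
      rw [← B₂.D_neg] at hwu
      obtain rfl := B₂.D_injective hwu
      rw [B₂.D_eq_zero_iff]
      rcases hu' with hu' | hu'
      · exact hu'
      · rcases hw' with hw' | hw'
        · exact neg_eq_zero.mp hw'
        · rw [B₁.D_neg] at hw'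
          exact absurd hw' hu'.not_neg)
  have hpos : ∀ u ∈ kerZ T, IsPos ord₁ (B₁.D u) → IsPos ord₂ (B₂.D u) := by
    intro u hu hu'
    refine hord _ ⟨u, hu, .inr hu', rfl⟩ fun h0 => hu'.ne_zero ?_
    rwa [B₁.D_eq_zero_iff, ← B₂.D_eq_zero_iff]
  refine ⟨ord₂, fun u hu => ⟨hpos u hu, fun hu' => ?_⟩⟩
  have hne : B₁.D u ≠ 0 := by
    rw [Ne, B₁.D_eq_zero_iff, ← B₂.D_eq_zero_iff]
    exact hu'.ne_zero
  refine (isPos_or_isPos_neg hne).resolve_right fun hneg => hu'.not_neg ?_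
  rw [← B₁.D_neg] at hneg
  rw [← B₂.D_neg]
  exact hpos _ (neg_mem hu) hneg

lemma posExp_D_le_iff_of_isRobust (h₁ : B₁.IsRobust K T ω) (h₂ : B₂.IsRobust K T ω)
    {u w : Fin s → ℤ} (hu : u ∈ kerZ T) :
    posExp (B₁.D u) ≤ posExp (B₁.D w) ↔ posExp (B₂.D u) ≤ posExp (B₂.D w) := by
  rw [h₁.posExp_D_le_iff hu, h₂.posExp_D_le_iff hu]

lemma OrdersCompatible.D_mem_reducedVectors_iff (hc : OrdersCompatible T B₁ B₂ ord₁ ord₂)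
    (h₁ : B₁.IsRobust K T ω) (h₂ : B₂.IsRobust K T ω) {u : Fin s → ℤ} :
    B₁.D u ∈ reducedVectors ord₁ A₁ ↔ B₂.D u ∈ reducedVectors ord₂ A₂ := by
  rw [h₁.D_mem_reducedVectors_iff, h₂.D_mem_reducedVectors_iff]
  refine and_congr_right fun hu => and_congr (hc u hu) (and_congr ?_ ?_)
  · refine forall₂_congr fun w hw => imp_congr (hc w hw) (imp_congr ?_ ?_)
    · exact posExp_D_le_iff_of_isRobust h₁ h₂ hw
    · exact posExp_D_le_iff_of_isRobust h₁ h₂ hu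
  · refine forall₂_congr fun w hw => imp_congr (hc w hw) (not_congr ?_)
    exact posExp_D_le_iff_of_isRobust h₁ h₂ hw

lemma OrdersCompatible.initialIdeal_eq_posMonomialIdeal
    (hc : OrdersCompatible T B₁ B₂ ord₁ ord₂) (h₁ : B₁.IsRobust K T ω) (h₂ : B₂.IsRobust K T ω)
    {U : Set (Fin s → ℤ)} (hU : U ⊆ kerZ T)
    (h : initialIdeal ord₁ (toricIdeal K A₁) = posMonomialIdeal K B₁.D U) :
    initialIdeal ord₂ (toricIdeal K A₂) = posMonomialIdeal K B₂.D U := by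
  rw [h₁.initialIdeal_eq_posMonomialIdeal_iff] at h
  rw [h₂.initialIdeal_eq_posMonomialIdeal_iff]
  refine ⟨fun u hu hpos => ?_, fun w hw => ?_⟩
  · obtain ⟨w, hw, hle⟩ := h.1 u hu ((hc u hu).mpr hpos)
    exact ⟨w, hw, (posExp_D_le_iff_of_isRobust h₁ h₂ (hU hw)).mp hle⟩
  · obtain ⟨u, hu, hpos, hle⟩ := h.2 w hw
    exact ⟨u, hu, (hc u hu).mp hpos, (posExp_D_le_iff_of_isRobust h₁ h₂ hu).mp hle⟩

/-- In characteristic two `u` and `-u` have the same binomial; the coincidences are the same for both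
matrices, so the transfer of a set of binomials is indexed by the same vectors. -/
lemma transfer_image {Q : Set (Fin s → ℤ)} (hQ : Q ⊆ kerZ T) :
    transfer K T B₁.D B₂.D ((fun u => binom K (B₁.D u)) '' Q) =
      (fun u => binom K (B₂.D u)) '' Q := by
  ext g
  constructor
  · rintro ⟨u, hu, ⟨w, hw, hwu⟩, rfl⟩
    refine ⟨w, hw, ?_⟩
    exact B₂.binom_D_eq_iff.mpr (B₁.binom_D_eq_iff.mp hwu)
  · rintro ⟨u, hu, rfl⟩
    exact ⟨u, hQ hu, ⟨u, hu, rfl⟩, rfl⟩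

/-- Transferring a set of binomials back recovers it. -/
lemma transfer_transfer {Q : Set (Fin s → ℤ)} (hQ : Q ⊆ kerZ T) :
    transfer K T B₂.D B₁.D
      (transfer K T B₁.D B₂.D ((fun u => binom K (B₁.D u)) '' Q)) =
        (fun u => binom K (B₁.D u)) '' Q := by
  rw [transfer_image hQ, transfer_image hQ]

lemma transfer_sUnion {D₁ : (Fin s → ℤ) → Fin n₁ → ℤ} {D₂ : (Fin s → ℤ) → Fin n₂ → ℤ}
    {𝒢 : Set (Set (MvPolynomial (Fin n₁) K))} :
    transfer K T D₁ D₂ (⋃₀ 𝒢) = ⋃₀ (transfer K T D₁ D₂ '' 𝒢) := by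
  ext g
  simp only [transfer, Set.mem_sUnion, Set.mem_image, Set.mem_ofPred_eq]
  constructor
  · rintro ⟨u, hu, ⟨G, hG, huG⟩, rfl⟩
    exact ⟨_, ⟨G, hG, rfl⟩, u, hu, huG, rfl⟩
  · rintro ⟨_, ⟨G, hG, rfl⟩, u, hu, huG, rfl⟩
    exact ⟨u, hu, ⟨G, hG, huG⟩, rfl⟩

lemma exists_equiv_transfer {S : Set (MvPolynomial (Fin n₁) K)}
    (hS : ∀ g ∈ S, ∃ u ∈ kerZ T, g = binom K (B₁.D u)) :
    ∃ f : S ≃ transfer K T B₁.D B₂.D S, ∀ u, ∀ hu : binom K (B₁.D u) ∈ S,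
      (f ⟨binom K (B₁.D u), hu⟩ : MvPolynomial (Fin n₂) K) = binom K (B₂.D u) := by
  choose! φ hφ hφ' using hS
  let f : S → transfer K T B₁.D B₂.D S := fun g =>
    ⟨binom K (B₂.D (φ g)), φ g, hφ g g.2, hφ' g g.2 ▸ g.2, rfl⟩
  have hf : ∀ u, ∀ hu : binom K (B₁.D u) ∈ S,
      (f ⟨binom K (B₁.D u), hu⟩ : MvPolynomial (Fin n₂) K) = binom K (B₂.D u) := fun u hu =>
    B₂.binom_D_eq_iff.mpr (B₁.binom_D_eq_iff.mp (hφ' _ hu).symm)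
  refine ⟨Equiv.ofBijective f ⟨fun g g' h => Subtype.ext ?_, ?_⟩, hf⟩
  · rw [hφ' g g.2, hφ' g' g'.2]
    exact B₁.binom_D_eq_iff.mpr (B₂.binom_D_eq_iff.mp (congrArg Subtype.val h))
  · rintro ⟨_, u, hu, huS, rfl⟩
    exact ⟨⟨_, huS⟩, Subtype.ext (hf u huS)⟩

lemma OrdersCompatible.isReducedGroebnerBasis_transfer
    (hc : OrdersCompatible T B₁ B₂ ord₁ ord₂) (h₁ : B₁.IsRobust K T ω) (h₂ : B₂.IsRobust K T ω)
    {G : Set (MvPolynomial (Fin n₁) K)} (hG : IsReducedGroebnerBasis ord₁ G (toricIdeal K A₁)) :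
    IsReducedGroebnerBasis ord₂ (transfer K T B₁.D B₂.D G) (toricIdeal K A₂) := by
  rw [isReducedGroebnerBasis_iff] at hG ⊢
  rw [hG, B₁.binom_image_reducedVectors, B₂.binom_image_reducedVectors,
    transfer_image fun u hu => h₁.D_mem_iff.mp hu.1]
  simp only [hc.D_mem_reducedVectors_iff h₁ h₂]

lemma mapsTo_transfer (hA₂ : IsPositivelyGraded A₂) (h₁ : B₁.IsRobust K T ω)
    (h₂ : B₂.IsRobust K T ω) :
    Set.MapsTo (transfer K T B₁.D B₂.D) (reducedGroebnerBases (toricIdeal K A₁))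
      (reducedGroebnerBases (toricIdeal K A₂)) := by
  rintro G ⟨ord₁, hG⟩
  obtain ⟨ord₂, hc⟩ := exists_ordersCompatible (B₁ := B₁) hA₂ h₂ ord₁
  exact ⟨ord₂, hc.isReducedGroebnerBasis_transfer h₁ h₂ hG⟩

lemma exists_eq_image_of_mem_reducedGroebnerBases (h₁ : B₁.IsRobust K T ω)
    {G : Set (MvPolynomial (Fin n₁) K)} (hG : G ∈ reducedGroebnerBases (toricIdeal K A₁)) :
    ∃ Q : Set (Fin s → ℤ), Q ⊆ kerZ T ∧ G = (fun u => binom K (B₁.D u)) '' Q := by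
  obtain ⟨ord₁, hG⟩ := hG
  rw [isReducedGroebnerBasis_iff, B₁.binom_image_reducedVectors] at hG
  exact ⟨_, fun u hu => h₁.D_mem_iff.mp hu.1, hG⟩

lemma leftInvOn_transfer (h₁ : B₁.IsRobust K T ω) :
    Set.LeftInvOn (transfer K T B₂.D B₁.D) (transfer K T B₁.D B₂.D)
      (reducedGroebnerBases (toricIdeal K A₁)) := by
  intro G hG
  obtain ⟨Q, hQ, rfl⟩ := exists_eq_image_of_mem_reducedGroebnerBases h₁ hG
  exact transfer_transfer hQ

lemma bijOn_transfer (hA₁ : IsPositivelyGraded A₁) (hA₂ : IsPositivelyGraded A₂)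
    (h₁ : B₁.IsRobust K T ω) (h₂ : B₂.IsRobust K T ω) :
    Set.BijOn (transfer K T B₁.D B₂.D)
      (reducedGroebnerBases (toricIdeal K A₁)) (reducedGroebnerBases (toricIdeal K A₂)) :=
  Set.InvOn.bijOn ⟨leftInvOn_transfer h₁, leftInvOn_transfer h₂⟩ (mapsTo_transfer hA₂ h₁ h₂)
    (mapsTo_transfer hA₁ h₂ h₁)

lemma universalGroebnerBasis_eq_transfer (hA₁ : IsPositivelyGraded A₁)
    (hA₂ : IsPositivelyGraded A₂) (h₁ : B₁.IsRobust K T ω) (h₂ : B₂.IsRobust K T ω) :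
    universalGroebnerBasis (toricIdeal K A₂) =
      transfer K T B₁.D B₂.D (universalGroebnerBasis (toricIdeal K A₁)) := by
  rw [universalGroebnerBasis, universalGroebnerBasis, transfer_sUnion,
    (bijOn_transfer hA₁ hA₂ h₁ h₂).image_eq]

lemma exists_finite_initialIdeal_eq (h₁ : B₁.IsRobust K T ω) (ord₁ : MonomialOrder (Fin n₁)) :
    ∃ U : Set (Fin s → ℤ), U.Finite ∧ U ⊆ kerZ T ∧
      initialIdeal ord₁ (toricIdeal K A₁) = posMonomialIdeal K B₁.D U := by
  refine ⟨B₁.D ⁻¹' reducedVectors ord₁ A₁, finite_reducedVectors.preimage B₁.D_injective.injOn,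
    fun u hu => h₁.D_mem_iff.mp hu.1, h₁.initialIdeal_eq_posMonomialIdeal_iff.mpr
      ⟨fun u hu hpos => ?_, fun w hw => ⟨w, h₁.D_mem_iff.mp hw.1, hw.2.1, le_rfl⟩⟩⟩
  obtain ⟨v, hv, hle⟩ := exists_mem_reducedVectors_posExp_le (h₁.D_mem_iff.mpr hu) hpos
  obtain ⟨w, -, rfl⟩ := B₁.exists_D_eq hv.1
  exact ⟨w, hv, hle⟩

end Transfer

end ToricBouquet

theorem theorem2p3 {K : Type*} [Field K] {m₁ m₂ n₁ n₂ p s : ℕ}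
    (A₁ : Matrix (Fin m₁) (Fin n₁) ℤ) (A₂ : Matrix (Fin m₂) (Fin n₂) ℤ)
    (hA₁ : IsPositivelyGraded A₁) (hA₂ : IsPositivelyGraded A₂)
    (T : Matrix (Fin p) (Fin s) ℤ) (hT : IsSimple T) (ω : Set (Fin s))
    (B₁ : BouquetData A₁ s) (B₂ : BouquetData A₂ s)
    (h₁ : B₁.IsRobust K T ω) (h₂ : B₂.IsRobust K T ω) :
    (∀ (ord₁ : MonomialOrder.{0, 0} (Fin n₁)) (G : Set (MvPolynomial (Fin n₁) K)),
      IsReducedGroebnerBasis ord₁ G (toricIdeal K A₁) →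
      ∃ ord₂ : MonomialOrder.{0, 0} (Fin n₂),
        IsReducedGroebnerBasis ord₂ (transfer K T B₁.D B₂.D G) (toricIdeal K A₂) ∧
        (∃ U : Set (Fin s → ℤ), U.Finite ∧ U ⊆ kerZ T ∧
          initialIdeal ord₁ (toricIdeal K A₁) = posMonomialIdeal K B₁.D U) ∧
        (∀ U : Set (Fin s → ℤ), U ⊆ kerZ T →
          initialIdeal ord₁ (toricIdeal K A₁) = posMonomialIdeal K B₁.D U →
          initialIdeal ord₂ (toricIdeal K A₂) = posMonomialIdeal K B₂.D U)) ∧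
    Set.BijOn (transfer K T B₁.D B₂.D)
      (reducedGroebnerBases (toricIdeal K A₁)) (reducedGroebnerBases (toricIdeal K A₂)) ∧
    universalGroebnerBasis (toricIdeal K A₂) =
      transfer K T B₁.D B₂.D (universalGroebnerBasis (toricIdeal K A₁)) ∧
    (∃ f : universalGroebnerBasis (toricIdeal K A₁) ≃ universalGroebnerBasis (toricIdeal K A₂),
      ∀ u ∈ kerZ T, ∀ hu : binom K (B₁.D u) ∈ universalGroebnerBasis (toricIdeal K A₁),
        (f ⟨binom K (B₁.D u), hu⟩ : MvPolynomial (Fin n₂) K) = binom K (B₂.D u)) := by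
  refine ⟨fun ord₁ G hG => ?_, bijOn_transfer hA₁ hA₂ h₁ h₂,
    universalGroebnerBasis_eq_transfer hA₁ hA₂ h₁ h₂, ?_⟩
  · obtain ⟨ord₂, hc⟩ := exists_ordersCompatible (B₁ := B₁) hA₂ h₂ ord₁
    exact ⟨ord₂, hc.isReducedGroebnerBasis_transfer h₁ h₂ hG,
      exists_finite_initialIdeal_eq h₁ ord₁,
      fun U hU => hc.initialIdeal_eq_posMonomialIdeal h₁ h₂ hU⟩
  · rw [universalGroebnerBasis_eq_transfer hA₁ hA₂ h₁ h₂]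
    obtain ⟨f, hf⟩ := exists_equiv_transfer (B₁ := B₁) (B₂ := B₂) (T := T)
      (S := universalGroebnerBasis (toricIdeal K A₁)) (by
        rintro g ⟨G, hG, hgG⟩
        obtain ⟨Q, hQ, rfl⟩ := exists_eq_image_of_mem_reducedGroebnerBases h₁ hG
        obtain ⟨u, hu, rfl⟩ := hgG
        exact ⟨u, hQ hu, rfl⟩)
    exact ⟨f, fun u _ => hf u⟩
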